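/- Let $m\in[1,\infty)$ be a real number and, on $\mathbb R^3=\mathbb C\times\mathbb R$ with points $(z,t)$, $z=x+iy$, consider the vector fields $$X=\partial_x+|z|^{2m}y\,\partial_t,\qquad Y=\partial_y-|z|^{2m}x\,\partial_t .$$ Let $d$ be the Carnot–Carathéodory distance of $X,Y$: $d(p,q)$ is the infimum of $\int_0^1|(\alpha(s),\beta(s))|\,ds$ over all absolutely continuous curves $\gamma:[0,1]\to\mathbb R^3$ with $\gamma(0)=p$, $\gamma(1)=q$ and $\dot\gamma=\alpha X(\gamma)+\beta Y(\gamma)$ a.e. on $[0,1]$. Let $B(p,r)$ denote the open balls and $\operatorname{diam}$ the diameter with respect to $d$. Let $\varphi\in C^\infty(\mathbb R^2)$ and suppose that there is a constant $C>0$ such that for all $z\in\mathbb R^2$ $$|D^3\varphi(z)|\le C|z|^{2m-1},\qquad |D^2\varphi(z)|\le C|z|^{2m},\qquad |D\varphi(z)|\le C|z|^{2m+1},$$ where $|D^k\varphi(z)|$ is the largest absolute value of a $k$-th order partial derivative of $\varphi$ at $z$. Then the epigraph $\Omega=\{(z,t)\in\mathbb R^3: t>\varphi(z)\}$ is a uniform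 domain for $d$; that is, $\Omega$ is open and there exist $\varepsilon>0$ and $\delta>0$ such that for all $p,q\in\Omega$ there is a continuous curve $\gamma:[0,1]\to\Omega$ with $\gamma(0)=p$, $\gamma(1)=q$, $$\operatorname{diam}(\gamma)\le\delta^{-1}d(p,q),$$ and, for every $t\in[0,1]$, $$B\big(\gamma(t),\,\varepsilon\min\{\operatorname{diam}(\gamma|_{[0,t]}),\operatorname{diam}(\gamma|_{[t,1]})\}\big)\subset\Omega .$$ -/

import Mathlib

open MeasureTheory Set
open scoped ENNReal ContDiff

noncomputable section

/-- The vector field `X = ∂_x + |z|^{2m} y ∂_t` on `ℝ³ = ℂ × ℝ`, at the point `(z, t)`, `z = x + iy`. -/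
def fieldX (m : ℝ) (p : ℂ × ℝ) : ℂ × ℝ :=
  (1, ‖p.1‖ ^ (2 * m) * p.1.im)

/-- The vector field `Y = ∂_y - |z|^{2m} x ∂_t` on `ℝ³ = ℂ × ℝ`, at the point `(z, t)`, `z = x + iy`. -/
def fieldY (m : ℝ) (p : ℂ × ℝ) : ℂ × ℝ :=
  (Complex.I, -(‖p.1‖ ^ (2 * m) * p.1.re))

/-- `γ` is an absolutely continuous curve on `[0,1]` which is horizontal with coefficients
`a, b`, that is, `γ' = a X(γ) + b Y(γ)` almost everywhere on `[0,1]`. -/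
structure IsHorizontalCurve (m : ℝ) (γ : ℝ → ℂ × ℝ) (a b : ℝ → ℝ) : Prop where
  absCont : AbsolutelyContinuousOnInterval γ 0 1
  hasDeriv : ∀ᵐ s ∂(volume.restrict (Icc (0 : ℝ) 1)),
    HasDerivAt γ (a s • fieldX m (γ s) + b s • fieldY m (γ s)) s

/-- The length `∫₀¹ |(a(s), b(s))| ds` of a horizontal curve with coefficients `a, b`. -/
def horizontalLength (a b : ℝ → ℝ) : ℝ≥0∞ :=
  ∫⁻ s in Icc (0 : ℝ) 1, ENNReal.ofReal (Real.sqrt (a s ^ 2 + b s ^ 2))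

/-- The Carnot-Carathéodory distance of `X` and `Y`: the infimum of the lengths of the horizontal
curves from `p` to `q`, as an extended nonnegative number. -/
def ccDist (m : ℝ) (p q : ℂ × ℝ) : ℝ≥0∞ :=
  ⨅ (γ : ℝ → ℂ × ℝ) (a : ℝ → ℝ) (b : ℝ → ℝ)
    (_ : IsHorizontalCurve m γ a b ∧ γ 0 = p ∧ γ 1 = q), horizontalLength a b

/-- The open ball of the Carnot-Carathéodory distance. -/
def ccBall (m : ℝ) (p : ℂ × ℝ) (r : ℝ≥0∞) : Set (ℂ × ℝ) :=
  {q | ccDist m p q < r}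

/-- The diameter of a set for the Carnot-Carathéodory distance. -/
def ccDiam (m : ℝ) (S : Set (ℂ × ℝ)) : ℝ≥0∞ :=
  ⨆ p ∈ S, ⨆ q ∈ S, ccDist m p q

/-- Uniform domains for the Carnot-Carathéodory distance. -/
def IsUniformDomain (m : ℝ) (Ω : Set (ℂ × ℝ)) : Prop :=
  IsOpen Ω ∧ ∃ ε > (0 : ℝ), ∃ δ > (0 : ℝ), ∀ p ∈ Ω, ∀ q ∈ Ω,
    ∃ γ : ℝ → ℂ × ℝ, ContinuousOn γ (Icc 0 1) ∧ MapsTo γ (Icc 0 1) Ω ∧ γ 0 = p ∧ γ 1 = q ∧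
      ccDiam m (γ '' Icc 0 1) ≤ ENNReal.ofReal δ⁻¹ * ccDist m p q ∧
      ∀ t ∈ Icc (0 : ℝ) 1,
        ccBall m (γ t)
          (ENNReal.ofReal ε * min (ccDiam m (γ '' Icc 0 t)) (ccDiam m (γ '' Icc t 1))) ⊆ Ω

/-- `|D^k φ(z)|`, the largest absolute value of a `k`-th order partial derivative of `φ` at `z`,
with respect to the real coordinates `x, y` of `z = x + iy`. -/
def maxPartial (k : ℕ) (φ : ℂ → ℝ) (z : ℂ) : ℝ :=
  ⨆ j : Fin k → Fin 2, |iteratedFDeriv ℝ k φ z (fun i => ![(1 : ℂ), Complex.I] (j i))|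

/-- The bounds, on all of `ℝ² = ℂ`, that define an entire `m`-admissible graph. -/
def IsAdmissible (m : ℝ) (φ : ℂ → ℝ) : Prop :=
  ∃ C > (0 : ℝ), ∀ z : ℂ,
    maxPartial 3 φ z ≤ C * ‖z‖ ^ (2 * m - 1) ∧
    maxPartial 2 φ z ≤ C * ‖z‖ ^ (2 * m) ∧
    maxPartial 1 φ z ≤ C * ‖z‖ ^ (2 * m + 1)

/-- The epigraph `{(z, t) : t > φ(z)}`. -/
def epi (φ : ℂ → ℝ) : Set (ℂ × ℝ) :=
  {p | φ p.1 < p.2}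

end

/-!
Let `n = 2m`, let `η = |z|^n (y dx - x dy)` be the contact form (`eta`), so that horizontal curves are
the curves with `dt = η`, and let `A = η - dφ` (`covec`). Along horizontal curves the height `t - φ z`
has derivative `A`, the horizontal gradient of the height. It depends on `z` only; for `p = (z, t)` write
`A p` for `A z` and `λ(p, s)` for the modulus `λ(z, s)` below.
The bounds on the second derivatives of `φ` and on `η` give
`|A w - A z| ≤ C λ(z, |w - z|)` with `λ(z, s) = s (|z| + s)^n` (`lam`, `HasCovecBound`); nothing else
about `φ` is needed.

Two facts on the distance `d` suffice. Integrating `A` along almost shortest curves shows that, in the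
ball of radius `ρ` around `p`, the height differs from its value at `p` by at most
`ρ (|A p| + C λ(p, ρ))` (`HasCovecBound.abs_height_sub_le`). Hence a point of larger height is the
center of a ball of radius `ρ` in the epigraph; and, for the affine `φ` with `A z = 0`, the vertical
gap of two points over `z` at distance less than `ρ` is at most a multiple of `ρ λ(z, ρ)`. Conversely,
loops made of two rays and two arcs around the origin show that points over `z` with vertical gap at
most `s λ(z, s)` have distance at most `4 s` (`ccDist_vertical_le`).

Let now `p` and `q` be points of the epigraph at distance about `r`. Each of them is the beginning of
an arc whose points have a distance to the graph which is at least a small multiple of the diameter of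
the arc so far (`JohnArc`), and the arcs reach a height so large that their end points can be joined,
by the lift of a segment followed by a vertical segment, at distance about `r` from the graph
(`JohnArc.connect`). There are two regimes.

* If `|A p|` is much larger than `λ(p, r)`, then `A` is almost constant at scale `r`, and both points
  move horizontally in the direction of `A p`
  (`HasCovecBound.exists_johnArcs_of_large`). It is essential that the direction is the same for both:
  the end points then differ in `z` by no more than `p` and `q` do.
* Otherwise each point moves horizontally in the direction of its own `A` as long as `A` dominates its
  oscillation, say for a length `L`, and then vertically (`HasCovecBound.exists_climb`). After the
  horizontal piece the height is at least of the order of `L λ(p, L)`, the variation of the height at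
  scale `L`, so that on the vertical piece the distance to the graph grows linearly in the scale. The
  height reached after `M r` beats the variation of the height at scale `r` if `M` is large
  (`HasCovecBound.exists_johnArcs_of_small`).
-/

/-! ### Reparametrization of absolutely continuous curves -/

theorem AbsolutelyContinuousOnInterval.lipschitz_comp {X Y : Type*} [PseudoMetricSpace X]
    [PseudoMetricSpace Y] {f : ℝ → X} {g : X → Y} {K : NNReal} {s : Set X} {a b : ℝ}
    (hg : LipschitzOnWith K g s) (hs : MapsTo f (uIcc a b) s)
    (hf : AbsolutelyContinuousOnInterval f a b) :
    AbsolutelyContinuousOnInterval (g ∘ f) a b := by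
  rw [absolutelyContinuousOnInterval_iff] at *
  intro ε hε
  obtain ⟨δ, hδ, h⟩ := hf (ε / (K + 1)) (by positivity)
  refine ⟨δ, hδ, fun E hE hEδ => ?_⟩
  calc ∑ i ∈ Finset.range E.1, dist ((g ∘ f) (E.2 i).1) ((g ∘ f) (E.2 i).2)
      ≤ ∑ i ∈ Finset.range E.1, K * dist (f (E.2 i).1) (f (E.2 i).2) :=
        Finset.sum_le_sum fun i hi =>
          hg.dist_le_mul _ (hs (hE.1 i hi).1) _ (hs (hE.1 i hi).2)
    _ = K * ∑ i ∈ Finset.range E.1, dist (f (E.2 i).1) (f (E.2 i).2) := by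
        rw [Finset.mul_sum]
    _ ≤ K * (ε / (K + 1)) := by gcongr; exact (h E hE hEδ).le
    _ < (K + 1) * (ε / (K + 1)) := by gcongr; linarith
    _ = ε := by field

/-- Monotone maps keep disjoint intervals disjoint, so reparametrizing by a monotone Lipschitz map
preserves absolute continuity. -/
theorem AbsolutelyContinuousOnInterval.comp_monotone {X : Type*} [PseudoMetricSpace X]
    {f : ℝ → X} {ψ : ℝ → ℝ} {K : NNReal} {a b c d : ℝ} (hψ : LipschitzWith K ψ)
    (hmono : Monotone ψ ∨ Antitone ψ) (hmaps : MapsTo ψ (uIcc a b) (uIcc c d))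
    (hf : AbsolutelyContinuousOnInterval f c d) :
    AbsolutelyContinuousOnInterval (f ∘ ψ) a b := by
  rw [absolutelyContinuousOnInterval_iff] at *
  intro ε hε
  obtain ⟨δ, hδ, h⟩ := hf ε hε
  refine ⟨δ / (K + 1), by positivity, fun E hE hEδ => ?_⟩
  refine h (E.1, fun i => (ψ (E.2 i).1, ψ (E.2 i).2)) ⟨fun i hi => ?_, ?_⟩ ?_
  · exact ⟨hmaps (hE.1 i hi).1, hmaps (hE.1 i hi).2⟩
  · intro i hi j hj hij
    have h2 := hE.2 hi hj hij
    simp only [Function.onFun, uIoc, Set.Ioc_disjoint_Ioc, min_le_iff, le_max_iff] at h2 ⊢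
    rcases hmono with hm | hm
    · simp only [← hm.map_max, ← hm.map_min]
      exact h2.imp (fun h => h.imp (fun h => hm h) fun h => hm h)
        (fun h => h.imp (fun h => hm h) fun h => hm h)
    · simp only [← hm.map_max, ← hm.map_min]
      rcases h2 with (h | h) | (h | h)
      · exact Or.inl (Or.inl (hm h))
      · exact Or.inr (Or.inl (hm h))
      · exact Or.inl (Or.inr (hm h))
      · exact Or.inr (Or.inr (hm h))
  · calc ∑ i ∈ Finset.range E.1, dist (ψ (E.2 i).1) (ψ (E.2 i).2)
        ≤ ∑ i ∈ Finset.range E.1, K * dist (E.2 i).1 (E.2 i).2 :=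
          Finset.sum_le_sum fun i _ => hψ.dist_le_mul _ _
      _ = K * ∑ i ∈ Finset.range E.1, dist (E.2 i).1 (E.2 i).2 := by rw [Finset.mul_sum]
      _ ≤ K * (δ / (K + 1)) := by gcongr
      _ < (K + 1) * (δ / (K + 1)) := by gcongr; linarith
      _ = δ := by field

/-- The bound on the increment of an absolutely continuous function by the integral of a bound of
its derivative. No measurability of the bound is required. -/
theorem AbsolutelyContinuousOnInterval.enorm_sub_le_lintegral {g : ℝ → ℝ} {a b : ℝ} (hab : a ≤ b)
    (hg : AbsolutelyContinuousOnInterval g a b) {F : ℝ → ℝ≥0∞}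
    (hF : ∀ᵐ s ∂(volume.restrict (Icc a b)), ‖deriv g s‖ₑ ≤ F s) :
    ‖g b - g a‖ₑ ≤ ∫⁻ s in Icc a b, F s := by
  rw [← hg.integral_deriv_eq_sub, intervalIntegral.integral_of_le hab,
    ← integral_Icc_eq_integral_Ioc]
  exact (enorm_integral_le_lintegral_enorm _).trans (lintegral_mono_ae hF)

theorem ae_comp_affine {P : ℝ → Prop} {c d a b : ℝ} (hc : c ≠ 0)
    (h : ∀ᵐ s ∂(volume.restrict (Icc a b)), P s) :
    ∀ᵐ s : ℝ, c * s + d ∈ Icc a b → P (c * s + d) := by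
  rw [ae_restrict_iff' measurableSet_Icc] at h
  have h1 : ∀ᵐ s : ℝ, (s + d) ∈ Icc a b → P (s + d) :=
    (measurePreserving_add_right volume d).quasiMeasurePreserving.ae h
  have h2 := Real.volume_preimage_mul_left hc {s | ¬ ((s + d) ∈ Icc a b → P (s + d))}
  rw [ae_iff] at h1 ⊢
  rw [h1, mul_zero] at h2
  exact h2

theorem lintegral_comp_affine (F : ℝ → ℝ≥0∞) {c d : ℝ} (hc : c ≠ 0) {s : Set ℝ}
    (hs : MeasurableSet s) :
    ∫⁻ x in s, ENNReal.ofReal |c| * F (c * x + d) = ∫⁻ x in (fun x => c * x + d) '' s, F x := by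
  rw [lintegral_image_eq_lintegral_abs_deriv_mul (f' := fun _ => c) hs]
  · intro x _
    simpa using (((hasDerivAt_id x).const_mul c).add_const d).hasDerivWithinAt
  · intro x _ y _ hxy
    simpa [hc] using hxy

/-! ### The Carnot-Carathéodory distance is a pseudodistance -/

theorem ccDist_le_of_curve {m : ℝ} {γ : ℝ → ℂ × ℝ} {a b : ℝ → ℝ} {p q : ℂ × ℝ}
    (h : IsHorizontalCurve m γ a b) (h0 : γ 0 = p) (h1 : γ 1 = q) :
    ccDist m p q ≤ horizontalLength a b :=
  iInf_le_of_le γ <| iInf_le_of_le a <| iInf_le_of_le b <| iInf_le _ ⟨h, h0, h1⟩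

theorem exists_curve_of_ccDist_lt {m : ℝ} {p q : ℂ × ℝ} {r : ℝ≥0∞} (h : ccDist m p q < r) :
    ∃ γ a b, IsHorizontalCurve m γ a b ∧ γ 0 = p ∧ γ 1 = q ∧ horizontalLength a b < r := by
  simp only [ccDist, iInf_lt_iff] at h
  obtain ⟨γ, a, b, ⟨h1, h2, h3⟩, h4⟩ := h
  exact ⟨γ, a, b, h1, h2, h3, h4⟩

theorem ccDist_self (m : ℝ) (p : ℂ × ℝ) : ccDist m p p = 0 := by
  refine le_antisymm ?_ (zero_le)
  refine (ccDist_le_of_curve (γ := fun _ => p) (a := 0) (b := 0) ⟨?_, ?_⟩ rfl rfl).trans ?_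
  · exact (LipschitzWith.const p).lipschitzOnWith.absolutelyContinuousOnInterval
  · refine Filter.Eventually.of_forall fun s => ?_
    simpa using hasDerivAt_const s p
  · simp [horizontalLength]

theorem sqrt_mul_sq_add (c x y : ℝ) :
    Real.sqrt ((c * x) ^ 2 + (c * y) ^ 2) = |c| * Real.sqrt (x ^ 2 + y ^ 2) := by
  rw [← Real.sqrt_sq_eq_abs, ← Real.sqrt_mul (sq_nonneg c)]
  congr 1; ring

theorem ccDist_comm_le (m : ℝ) (p q : ℂ × ℝ) : ccDist m q p ≤ ccDist m p q := by
  refine le_of_forall_gt fun r hr => ?_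
  obtain ⟨γ, a, b, h, h0, h1, hl⟩ := exists_curve_of_ccDist_lt hr
  refine lt_of_le_of_lt ?_ hl
  refine (ccDist_le_of_curve (γ := γ ∘ fun s => -1 * s + 1) (a := fun s => -1 * a (-1 * s + 1))
    (b := fun s => -1 * b (-1 * s + 1)) ⟨?_, ?_⟩ (by simpa using h1) (by simpa using h0)).trans ?_
  · refine h.absCont.comp_monotone (K := 1) ?_ (Or.inr fun x y hxy => by dsimp only; linarith) ?_
    · exact LipschitzWith.of_dist_le_mul fun x y => by
        simp [Real.dist_eq]
    · intro x hx
      rw [uIcc_of_le zero_le_one] at *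
      constructor <;> linarith [hx.1, hx.2]
  · rw [ae_restrict_iff' measurableSet_Icc]
    filter_upwards [ae_comp_affine (c := -1) (d := 1) (by norm_num) h.hasDeriv] with s hs hs'
    have := (hs ⟨by linarith [hs'.2], by linarith [hs'.1]⟩).scomp s
      (((hasDerivAt_id s).const_mul (-1)).add_const 1)
    refine this.congr_deriv ?_
    rw [smul_add, smul_smul, smul_smul, mul_one]
    rfl
  · simp only [horizontalLength, sqrt_mul_sq_add]
    refine le_of_eq ?_
    have h2 := lintegral_comp_affine (fun s => ENNReal.ofReal (Real.sqrt (a s ^ 2 + b s ^ 2)))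
      (c := -1) (d := 1) (by norm_num) (measurableSet_Icc (a := (0 : ℝ)) (b := 1))
    have h3 : (fun x : ℝ => -1 * x + 1) '' Icc 0 1 = Icc 0 1 := by
      ext y
      simp only [mem_image, mem_Icc]
      constructor
      · rintro ⟨x, hx, rfl⟩; constructor <;> linarith
      · intro hy; exact ⟨1 - y, ⟨by linarith, by linarith⟩, by ring⟩
    rw [h3] at h2
    rw [← h2]
    simp

theorem ccDist_comm (m : ℝ) (p q : ℂ × ℝ) : ccDist m p q = ccDist m q p :=
  le_antisymm (ccDist_comm_le m q p) (ccDist_comm_le m p q)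

theorem ccDist_triangle (m : ℝ) (p q r : ℂ × ℝ) :
    ccDist m p r ≤ ccDist m p q + ccDist m q r := by
  -- concatenate curves which are slightly longer than the two distances
  refine le_of_forall_gt fun c hc => ?_
  obtain ⟨c₁, hc₁, c₂, hc₂, hcc⟩ : ∃ c₁ > ccDist m p q, ∃ c₂ > ccDist m q r, c₁ + c₂ < c := by
    obtain ⟨c', h1, h2⟩ := exists_between hc
    have hne : ccDist m p q ≠ ⊤ := fun h => by simp [h] at hc
    have hne2 : ccDist m q r ≠ ⊤ := fun h => by simp [h] at hc
    obtain ⟨ε, hε, h3⟩ := ENNReal.exists_pos_sum_of_countable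
      (ε := c' - (ccDist m p q + ccDist m q r)) (tsub_pos_of_lt h1).ne' (Fin 2)
    simp only [tsum_fintype, Fin.sum_univ_two] at h3
    have h4 : ∀ i, (0 : ℝ≥0∞) < ε i := fun i => by exact_mod_cast hε i
    refine ⟨ccDist m p q + ε 0, ENNReal.lt_add_right hne (h4 0).ne',
      ccDist m q r + ε 1, ENNReal.lt_add_right hne2 (h4 1).ne', lt_of_le_of_lt ?_ h2⟩
    rw [add_add_add_comm]
    have := h3.le
    calc _ ≤ ccDist m p q + ccDist m q r + (c' - (ccDist m p q + ccDist m q r)) := by gcongr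
      _ = c' := by rw [add_tsub_cancel_of_le h1.le]
  obtain ⟨γ₁, a₁, b₁, h, h0, h1, hl⟩ := exists_curve_of_ccDist_lt hc₁
  obtain ⟨γ₂, a₂, b₂, h', h0', h1', hl'⟩ := exists_curve_of_ccDist_lt hc₂
  refine lt_of_le_of_lt ?_ ((add_le_add hl.le hl'.le).trans_lt hcc)
  refine (ccDist_le_of_curve
    -- a sum of clamped curves, whose absolute continuity needs no gluing
    (γ := fun s => (γ₁ ∘ fun s => min (2 * s + 0) 1) s + (γ₂ ∘ fun s => max (2 * s + -1) 0) s - q)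
    (a := fun s => if s < 1 / 2 then 2 * a₁ (2 * s + 0) else 2 * a₂ (2 * s + -1))
    (b := fun s => if s < 1 / 2 then 2 * b₁ (2 * s + 0) else 2 * b₂ (2 * s + -1))
    ⟨?_, ?_⟩ (by simp [h0, h0']) (by norm_num [h1, h1'])).trans ?_
  · have l1 : LipschitzWith 2 (fun s : ℝ => 2 * s + 0) :=
      LipschitzWith.of_dist_le_mul fun x y => by
        simp [Real.dist_eq, ← mul_sub, abs_mul]
    have l2 : LipschitzWith 2 (fun s : ℝ => 2 * s + -1) :=
      LipschitzWith.of_dist_le_mul fun x y => by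
        simp [Real.dist_eq, ← mul_sub, abs_mul]
    refine AbsolutelyContinuousOnInterval.fun_sub (AbsolutelyContinuousOnInterval.fun_add ?_ ?_)
      ((LipschitzWith.const q).lipschitzOnWith.absolutelyContinuousOnInterval)
    · refine h.absCont.comp_monotone (l1.min_const 1) (Or.inl ?_) ?_
      · intro x y hxy
        dsimp only; gcongr
      · intro x hx
        rw [uIcc_of_le zero_le_one] at *
        exact ⟨le_min (by linarith [hx.1]) zero_le_one, min_le_right _ _⟩
    · refine h'.absCont.comp_monotone (l2.max_const 0) (Or.inl ?_) ?_
      · intro x y hxy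
        dsimp only; gcongr
      · intro x hx
        rw [uIcc_of_le zero_le_one] at *
        exact ⟨le_max_right _ _, max_le (by linarith [hx.2]) zero_le_one⟩
  · rw [ae_restrict_iff' measurableSet_Icc]
    have hne : ∀ᵐ s : ℝ, s ≠ 1 / 2 := by simp [ae_iff]
    filter_upwards [ae_comp_affine (c := 2) (d := 0) (by norm_num) h.hasDeriv,
      ae_comp_affine (c := 2) (d := -1) (by norm_num) h'.hasDeriv, hne] with s hs hs2 hs3 hs'
    rcases lt_or_gt_of_ne hs3 with hlt | hlt
    · have h5 := (hs ⟨by linarith [hs'.1], by linarith [hs'.1]⟩).scomp s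
        (((hasDerivAt_id s).const_mul 2).add_const 0)
      have h6 : (fun s => (γ₁ ∘ fun s => min (2 * s + 0) 1) s
          + (γ₂ ∘ fun s => max (2 * s + -1) 0) s - q) =ᶠ[nhds s] γ₁ ∘ fun s => 2 * s + 0 := by
        filter_upwards [Iio_mem_nhds hlt] with x hx
        have hx : x < 1 / 2 := hx
        have e1 : min (2 * x + 0) 1 = 2 * x + 0 := min_eq_left (by linarith)
        have e2 : max (2 * x + -1) 0 = 0 := max_eq_right (by linarith)
        simp only [Function.comp, e1, e2, h0']
        simp
      have h7 := h5.congr_of_eventuallyEq h6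
      refine h7.congr_deriv ?_
      rw [h6.eq_of_nhds, smul_add, smul_smul, smul_smul, mul_one, if_pos hlt, if_pos hlt]
      rfl
    · have h5 := (hs2 ⟨by linarith [hs'.1], by linarith [hs'.2]⟩).scomp s
        (((hasDerivAt_id s).const_mul 2).add_const (-1))
      have h6 : (fun s => (γ₁ ∘ fun s => min (2 * s + 0) 1) s
          + (γ₂ ∘ fun s => max (2 * s + -1) 0) s - q) =ᶠ[nhds s] γ₂ ∘ fun s => 2 * s + -1 := by
        filter_upwards [Ioi_mem_nhds hlt] with x hx
        have hx : 1 / 2 < x := hx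
        have e1 : min (2 * x + 0) 1 = 1 := min_eq_right (by linarith)
        have e2 : max (2 * x + -1) 0 = 2 * x + -1 := max_eq_left (by linarith)
        simp only [Function.comp, e1, e2, h1]
        simp
      have h7 := h5.congr_of_eventuallyEq h6
      refine h7.congr_deriv ?_
      rw [h6.eq_of_nhds, smul_add, smul_smul, smul_smul, mul_one, if_neg hlt.not_gt, if_neg hlt.not_gt]
      rfl
  · have hi1 : (fun x : ℝ => 2 * x + 0) '' Ico 0 (1 / 2) ⊆ Icc 0 1 := by
      rintro _ ⟨x, hx, rfl⟩; constructor <;> dsimp only <;> linarith [hx.1, hx.2]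
    have hi2 : (fun x : ℝ => 2 * x + -1) '' Icc (1 / 2) 1 ⊆ Icc 0 1 := by
      rintro _ ⟨x, hx, rfl⟩; constructor <;> dsimp only <;> linarith [hx.1, hx.2]
    have hu : Icc (0 : ℝ) 1 = Ico 0 (1 / 2) ∪ Icc (1 / 2) 1 :=
      (Ico_union_Icc_eq_Icc (by norm_num) (by norm_num)).symm
    rw [horizontalLength, hu]
    refine (lintegral_union_le _ _ _).trans (add_le_add ?_ ?_)
    · refine le_trans (le_of_eq ?_) (lintegral_mono_set hi1)
      rw [← lintegral_comp_affine _ (by norm_num) measurableSet_Ico]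
      refine setLIntegral_congr_fun measurableSet_Ico fun s hs => ?_
      simp only [if_pos hs.2, sqrt_mul_sq_add]
      rw [ENNReal.ofReal_mul (abs_nonneg _)]
    · refine le_trans (le_of_eq ?_) (lintegral_mono_set hi2)
      rw [← lintegral_comp_affine _ (by norm_num) measurableSet_Icc]
      refine setLIntegral_congr_fun measurableSet_Icc fun s hs => ?_
      simp only [if_neg hs.1.not_gt, sqrt_mul_sq_add]
      rw [ENNReal.ofReal_mul (abs_nonneg _)]

/-! ### The contact form and its oscillation -/

/-- The modulus `s (|z| + s) ^ (2m)`, which measures the oscillation of the contact form at scale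
`s` around `z`; a ball of radius `s` around `(z, t)` has height comparable to `s * lam m z s`. -/
noncomputable def lam (m : ℝ) (z : ℂ) (s : ℝ) : ℝ := s * (‖z‖ + s) ^ (2 * m)

/-- The contact form `|z|^{2m} (y dx - x dy)` as a covector field on `ℂ`: the horizontal lift of a
planar velocity `c` at `z` is `(c, eta m z c)`. -/
noncomputable def eta (m : ℝ) (z : ℂ) : ℂ →L[ℝ] ℝ :=
  innerSL ℝ (((‖z‖ ^ (2 * m) : ℝ) : ℂ) * (-Complex.I * z))

/-- The height `t - φ z` of `(z, t)` above the graph of `φ`. -/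
def height (φ : ℂ → ℝ) (p : ℂ × ℝ) : ℝ := p.2 - φ p.1

/-- The derivative of the height along horizontal curves, a covector field on `ℂ`; it is the
horizontal gradient of `t - φ z`. -/
noncomputable def covec (m : ℝ) (φ : ℂ → ℝ) (z : ℂ) : ℂ →L[ℝ] ℝ := eta m z - fderiv ℝ φ z

/-- The function `φ` is continuously differentiable and the horizontal gradient of its height
oscillates at scale `s` around `z` by at most `C * lam m z s`. -/
structure HasCovecBound (m C : ℝ) (φ : ℂ → ℝ) : Prop where
  contDiff : ContDiff ℝ 1 φ
  bound : ∀ z w, ‖covec m φ w - covec m φ z‖ ≤ C * lam m z ‖w - z‖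

theorem lam_nonneg (m : ℝ) (z : ℂ) {s : ℝ} (hs : 0 ≤ s) : 0 ≤ lam m z s := by
  unfold lam; positivity

theorem lam_mono {m : ℝ} (hm : 1 ≤ m) {z : ℂ} {s t r : ℝ} (hs : 0 ≤ s) (hst : s ≤ t)
    (h : ‖z‖ + s ≤ r) : lam m z s ≤ t * r ^ (2 * m) := by
  unfold lam
  have : 0 ≤ ‖z‖ := norm_nonneg z
  have : 0 ≤ t := hs.trans hst
  gcongr

theorem lam_le_lam {m : ℝ} (hm : 1 ≤ m) (z : ℂ) {s t : ℝ} (hs : 0 ≤ s) (hst : s ≤ t) :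
    lam m z s ≤ lam m z t :=
  lam_mono hm hs hst (by gcongr)

theorem mul_lam_le {m : ℝ} (hm : 1 ≤ m) (z : ℂ) {s k : ℝ} (hs : 0 ≤ s) (hk : 1 ≤ k) :
    k * lam m z s ≤ lam m z (k * s) := by
  unfold lam
  have : 0 ≤ ‖z‖ := norm_nonneg z
  have h1 : s ≤ k * s := le_mul_of_one_le_left hs hk
  rw [← mul_assoc]
  gcongr

theorem eta_apply (m : ℝ) (z c : ℂ) : eta m z c = ‖z‖ ^ (2 * m) * (z.im * c.re - z.re * c.im) := by
  simp only [eta, innerSL_apply_apply, Complex.inner, Complex.mul_re, Complex.mul_im,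
    Complex.conj_re, Complex.conj_im, Complex.neg_re, Complex.neg_im, Complex.I_re, Complex.I_im,
    Complex.ofReal_re, Complex.ofReal_im]
  ring

theorem continuous_eta {m : ℝ} (hm : 1 ≤ m) : Continuous (eta m) := by
  unfold eta
  refine (innerSL ℝ).continuous.comp (Continuous.mul ?_ (by fun_prop))
  exact Complex.continuous_ofReal.comp
    (continuous_norm.rpow_const fun x => Or.inr (by positivity))

theorem rpow_sub_rpow_mul_le {n a b : ℝ} (hn : 1 ≤ n) (hb : 0 ≤ b) (hab : b ≤ a) :
    (a ^ n - b ^ n) * b ≤ n * a ^ n * (a - b) := by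
  rcases hab.eq_or_lt with rfl | hlt
  · simp
  have ha : 0 < a := hb.trans_lt hlt
  have h1 := one_add_mul_self_le_rpow_one_add (s := b / a - 1)
    (by have := div_nonneg hb ha.le; linarith) hn
  rw [add_sub_cancel, Real.div_rpow hb ha.le, le_div_iff₀ (by positivity)] at h1
  have h2 : a ^ n - b ^ n ≤ n * a ^ n * ((a - b) / a) := by
    have : (a - b) / a = -(b / a - 1) := by field_simp; ring
    rw [this]; linarith
  have hn0 : 0 ≤ n * a ^ n := by positivity
  calc (a ^ n - b ^ n) * b ≤ (a ^ n - b ^ n) * a := by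
        have := Real.rpow_le_rpow hb hab (by linarith : 0 ≤ n)
        gcongr
    _ ≤ n * a ^ n * ((a - b) / a) * a := by gcongr
    _ = n * a ^ n * (a - b) := by field_simp

theorem norm_eta_sub_le {m : ℝ} (hm : 1 ≤ m) (z w : ℂ) :
    ‖eta m w - eta m z‖ ≤ (2 * m + 1) * lam m z ‖w - z‖ := by
  have hw : ‖w‖ ≤ ‖z‖ + ‖w - z‖ := norm_le_norm_add_norm_sub' w z
  have hz : ‖z‖ ≤ ‖z‖ + ‖w - z‖ := by linarith [norm_nonneg (w - z)]
  have h0 : ‖eta m w - eta m z‖ =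
      ‖((‖w‖ ^ (2 * m) : ℝ) : ℂ) * w - ((‖z‖ ^ (2 * m) : ℝ) : ℂ) * z‖ := by
    unfold eta
    rw [← map_sub, innerSL_apply_norm]
    rw [show ((‖w‖ ^ (2 * m) : ℝ) : ℂ) * (-Complex.I * w)
      - ((‖z‖ ^ (2 * m) : ℝ) : ℂ) * (-Complex.I * z) = -Complex.I *
        (((‖w‖ ^ (2 * m) : ℝ) : ℂ) * w - ((‖z‖ ^ (2 * m) : ℝ) : ℂ) * z) by ring]
    simp
  -- `a` and `b` are `z` and `w` in the order of their moduli
  have key : ∀ a b : ℂ, ‖b‖ ≤ ‖a‖ → ‖a‖ ≤ ‖z‖ + ‖w - z‖ → ‖a - b‖ = ‖w - z‖ →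
      ‖((‖a‖ ^ (2 * m) : ℝ) : ℂ) * a - ((‖b‖ ^ (2 * m) : ℝ) : ℂ) * b‖
        ≤ (2 * m + 1) * lam m z ‖w - z‖ := by
    intro a b hab ha hd
    have h1 := rpow_sub_rpow_mul_le (n := 2 * m) (by linarith) (norm_nonneg b) hab
    have h2 := Real.rpow_le_rpow (norm_nonneg b) hab (by linarith : 0 ≤ 2 * m)
    have h3 := Real.rpow_le_rpow (norm_nonneg a) ha (by linarith : 0 ≤ 2 * m)
    have h4 : ‖a‖ - ‖b‖ ≤ ‖w - z‖ := hd ▸ norm_sub_norm_le a b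
    rw [show ((‖a‖ ^ (2 * m) : ℝ) : ℂ) * a - ((‖b‖ ^ (2 * m) : ℝ) : ℂ) * b =
      ((‖a‖ ^ (2 * m) : ℝ) : ℂ) * (a - b) + ((‖a‖ ^ (2 * m) - ‖b‖ ^ (2 * m) : ℝ) : ℂ) * b by
        push_cast; ring]
    refine (norm_add_le _ _).trans ?_
    rw [norm_mul, norm_mul, Complex.norm_real, Complex.norm_real, Real.norm_eq_abs,
      Real.norm_eq_abs, abs_of_nonneg (by positivity), abs_of_nonneg (by linarith), hd]
    calc ‖a‖ ^ (2 * m) * ‖w - z‖ + (‖a‖ ^ (2 * m) - ‖b‖ ^ (2 * m)) * ‖b‖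
        ≤ ‖a‖ ^ (2 * m) * ‖w - z‖ + 2 * m * ‖a‖ ^ (2 * m) * ‖w - z‖ := by
          refine add_le_add le_rfl (h1.trans ?_)
          gcongr
      _ = (2 * m + 1) * (‖w - z‖ * ‖a‖ ^ (2 * m)) := by ring
      _ ≤ _ := by
          unfold lam
          gcongr
  rw [h0]
  rcases le_total ‖z‖ ‖w‖ with h | h
  · exact key w z h hw rfl
  · rw [norm_sub_rev]
    exact key z w h hz (norm_sub_rev z w)

/-! ### Lower bounds for the distance -/

theorem smul_fieldX_add_smul_fieldY (m : ℝ) (p : ℂ × ℝ) (a b : ℝ) :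
    a • fieldX m p + b • fieldY m p = ((⟨a, b⟩ : ℂ), eta m p.1 ⟨a, b⟩) := by
  refine Prod.ext ?_ ?_
  · apply Complex.ext <;> simp [fieldX, fieldY]
  · simp only [fieldX, fieldY, Prod.snd_add, Prod.smul_mk, smul_eq_mul, eta_apply]
    ring

theorem IsHorizontalCurve.enorm_sub_le {m : ℝ} {γ : ℝ → ℂ × ℝ} {a b : ℝ → ℝ}
    (h : IsHorizontalCurve m γ a b) {G : ℂ × ℝ → ℝ} (hG : ContDiff ℝ 1 G) {B T : ℝ}
    (hT : T ∈ Icc (0 : ℝ) 1)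
    (hB : ∀ s ∈ Icc 0 T, ∀ c : ℂ, |fderiv ℝ G (γ s) (c, eta m (γ s).1 c)| ≤ B * ‖c‖) :
    ‖G (γ T) - G (γ 0)‖ₑ ≤ ENNReal.ofReal B * horizontalLength a b := by
  have hB0 : 0 ≤ B := by
    have := hB 0 ⟨le_rfl, hT.1⟩ 1
    rw [norm_one, mul_one] at this
    exact (abs_nonneg _).trans this
  have hsub : Icc 0 T ⊆ Icc (0 : ℝ) 1 := Icc_subset_Icc_right hT.2
  have hγ : AbsolutelyContinuousOnInterval γ 0 T := h.absCont.mono (by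
    rwa [uIcc_of_le hT.1, uIcc_of_le zero_le_one])
  obtain ⟨R, hR⟩ := hγ.exists_bound
  obtain ⟨K, hK⟩ := (hG.contDiffOn (s := Metric.closedBall (0 : ℂ × ℝ) R)).exists_lipschitzOnWith
    one_ne_zero (convex_closedBall _ _) (isCompact_closedBall _ _)
  have hGγ : AbsolutelyContinuousOnInterval (G ∘ γ) 0 T :=
    hγ.lipschitz_comp hK fun x hx => by simpa using hR x hx
  have h1 := hGγ.enorm_sub_le_lintegral hT.1
    (F := fun s => ENNReal.ofReal B * ENNReal.ofReal (Real.sqrt (a s ^ 2 + b s ^ 2))) ?_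
  · refine h1.trans ?_
    rw [lintegral_const_mul' _ _ ENNReal.ofReal_ne_top]
    exact mul_le_mul_right (lintegral_mono_set hsub) _
  · have h2 := ae_restrict_of_ae_restrict_of_subset hsub h.hasDeriv
    filter_upwards [h2, ae_restrict_mem measurableSet_Icc] with s hs hs'
    have h3 := ((hG.differentiable one_ne_zero (γ s)).hasFDerivAt.comp_hasDerivAt s hs).deriv
    rw [h3, smul_fieldX_add_smul_fieldY, Real.enorm_eq_ofReal_abs, ← ENNReal.ofReal_mul hB0]
    refine ENNReal.ofReal_le_ofReal ?_
    have h4 := hB s hs' ⟨a s, b s⟩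
    rwa [Complex.norm_eq_sqrt_sq_add_sq] at h4

theorem IsHorizontalCurve.enorm_fst_sub_le {m : ℝ} {γ : ℝ → ℂ × ℝ} {a b : ℝ → ℝ}
    (h : IsHorizontalCurve m γ a b) {T : ℝ} (hT : T ∈ Icc (0 : ℝ) 1) :
    ‖(γ T).1 - (γ 0).1‖ₑ ≤ horizontalLength a b := by
  set w := (γ T).1 - (γ 0).1 with hw
  rcases eq_or_ne w 0 with h0 | h0
  · simp [h0]
  -- project the displacement `w` onto its own direction
  have h1 := h.enorm_sub_le (G := fun p => ((innerSL ℝ w).comp (ContinuousLinearMap.fst ℝ ℂ ℝ)) p)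
    (ContinuousLinearMap.contDiff _) (B := ‖w‖) hT fun s _ c => by
      rw [ContinuousLinearMap.fderiv]
      simpa using abs_real_inner_le_norm w c
  rw [← map_sub] at h1
  simp only [ContinuousLinearMap.comp_apply, ContinuousLinearMap.coe_fst', Prod.fst_sub, ← hw,
    innerSL_apply_apply, real_inner_self_eq_norm_mul_norm] at h1
  rw [enorm_mul, enorm_norm, ofReal_norm] at h1
  exact (ENNReal.mul_le_mul_iff_right (by simpa using h0) (by simp)).1 h1

theorem hasFDerivAt_height {φ : ℂ → ℝ} (hφ : ContDiff ℝ 1 φ) (p : ℂ × ℝ) :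
    HasFDerivAt (height φ) (ContinuousLinearMap.snd ℝ ℂ ℝ -
      (fderiv ℝ φ p.1).comp (ContinuousLinearMap.fst ℝ ℂ ℝ)) p :=
  hasFDerivAt_snd.sub
    ((hφ.differentiable one_ne_zero p.1).hasFDerivAt.comp p hasFDerivAt_fst)

theorem contDiff_height {φ : ℂ → ℝ} (hφ : ContDiff ℝ 1 φ) : ContDiff ℝ 1 (height φ) :=
  contDiff_snd.sub (hφ.comp contDiff_fst)

theorem fst_sub_le_of_ccDist_lt {m : ℝ} {p q : ℂ × ℝ} {ρ : ℝ}
    (h : ccDist m p q < ENNReal.ofReal ρ) : ‖q.1 - p.1‖ ≤ ρ := by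
  obtain ⟨γ, a, b, hγ, rfl, rfl, hl⟩ := exists_curve_of_ccDist_lt h
  have := (hγ.enorm_fst_sub_le (T := 1) (by simp)).trans_lt hl
  rw [← ofReal_norm] at this
  exact (ENNReal.ofReal_lt_ofReal_iff_of_nonneg (norm_nonneg _)).1 this |>.le

theorem HasCovecBound.norm_covec_le {m C : ℝ} {φ : ℂ → ℝ} (hφ : HasCovecBound m C φ) (z w : ℂ) :
    ‖covec m φ w‖ ≤ ‖covec m φ z‖ + C * lam m z ‖w - z‖ :=
  (norm_le_norm_add_norm_sub' _ (covec m φ z)).trans (by gcongr; exact hφ.bound z w)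

/-- The variation of the height in a ball of radius `ρ`. -/
theorem HasCovecBound.abs_height_sub_le {m C : ℝ} (hm : 1 ≤ m) (hC : 0 ≤ C) {φ : ℂ → ℝ}
    (hφ : HasCovecBound m C φ) {p q : ℂ × ℝ} {ρ : ℝ} (h : ccDist m p q < ENNReal.ofReal ρ) :
    |height φ q - height φ p| ≤ ρ * (‖covec m φ p.1‖ + C * lam m p.1 ρ) := by
  have hρ : 0 < ρ := by
    by_contra! hc
    simp [ENNReal.ofReal_of_nonpos hc] at h
  obtain ⟨γ, a, b, hγ, rfl, rfl, hl⟩ := exists_curve_of_ccDist_lt h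
  set B := ‖covec m φ (γ 0).1‖ + C * lam m (γ 0).1 ρ with hB
  have hB0 : 0 ≤ B := by have := lam_nonneg m (γ 0).1 hρ.le; positivity
  have h1 := hγ.enorm_sub_le (contDiff_height hφ.contDiff) (B := B) (T := 1) (by simp) ?_
  · have h2 := h1.trans (mul_le_mul_right hl.le _)
    rw [← ENNReal.ofReal_mul hB0, Real.enorm_eq_ofReal_abs,
      ENNReal.ofReal_le_ofReal_iff (by positivity)] at h2
    linarith
  · intro s hs c
    rw [(hasFDerivAt_height hφ.contDiff _).fderiv]
    have h3 : (ContinuousLinearMap.snd ℝ ℂ ℝ - (fderiv ℝ φ (γ s).1).comp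
        (ContinuousLinearMap.fst ℝ ℂ ℝ)) (c, eta m (γ s).1 c) = covec m φ (γ s).1 c := by
      simp [covec]
    rw [h3, ← Real.norm_eq_abs]
    refine (ContinuousLinearMap.le_opNorm _ _).trans ?_
    gcongr
    refine (hφ.norm_covec_le (γ 0).1 (γ s).1).trans ?_
    rw [hB]
    have h4 := (hγ.enorm_fst_sub_le hs).trans_lt hl
    rw [← ofReal_norm] at h4
    have h5 := ((ENNReal.ofReal_lt_ofReal_iff_of_nonneg (norm_nonneg _)).1 h4).le
    gcongr
    exact lam_le_lam hm _ (norm_nonneg _) h5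

/-- The height of a vertical segment is bounded by its diameter. This is the estimate for the
height above the plane which is tangent to the horizontal distribution at the base point. -/
theorem abs_snd_sub_le_of_ccDist_lt {m : ℝ} (hm : 1 ≤ m) {z : ℂ} {t t' ρ : ℝ}
    (h : ccDist m (z, t) (z, t') < ENNReal.ofReal ρ) :
    |t' - t| ≤ (2 * m + 1) * (ρ * lam m z ρ) := by
  have hd : ∀ w, covec m (eta m z) w = eta m w - eta m z := fun w => by
    simp [covec]
  have hφ : HasCovecBound m (2 * m + 1) (eta m z) :=
    ⟨ContinuousLinearMap.contDiff _, fun x w => by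
      rw [hd, hd, sub_sub_sub_cancel_right]
      exact norm_eta_sub_le hm x w⟩
  have := hφ.abs_height_sub_le hm (by linarith) h
  rw [hd] at this
  simp only [height, sub_self, norm_zero, sub_sub_sub_cancel_right] at this
  linarith

/-! ### Upper bounds for the distance -/

/-- A smooth lift of a planar curve of speed at most `ℓ` has length at most `ℓ`. -/
theorem ccDist_le_of_hasDerivAt {m : ℝ} (hm : 1 ≤ m) {γ : ℝ → ℂ × ℝ} {c : ℝ → ℂ}
    (hc : Continuous c) (hγ : ∀ s, HasDerivAt γ (c s, eta m (γ s).1 (c s)) s) {ℓ : ℝ}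
    (hℓ : ∀ s, ‖c s‖ ≤ ℓ) : ccDist m (γ 0) (γ 1) ≤ ENNReal.ofReal ℓ := by
  have hcont : Continuous γ := continuous_iff_continuousAt.2 fun s => (hγ s).continuousAt
  have hC1 : ContDiff ℝ 1 γ := by
    rw [contDiff_one_iff_deriv]
    refine ⟨fun s => (hγ s).differentiableAt, ?_⟩
    rw [show deriv γ = fun s => (c s, eta m (γ s).1 (c s)) from funext fun s => (hγ s).deriv]
    exact hc.prodMk (((continuous_eta hm).comp (continuous_fst.comp hcont)).clm_apply hc)
  refine (ccDist_le_of_curve (a := fun s => (c s).re) (b := fun s => (c s).im)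
    ⟨hC1.contDiffOn.absolutelyContinuousOnInterval, ?_⟩ rfl rfl).trans ?_
  · refine Filter.Eventually.of_forall fun s => ?_
    rw [smul_fieldX_add_smul_fieldY]
    exact hγ s
  · calc horizontalLength (fun s => (c s).re) (fun s => (c s).im)
        ≤ ∫⁻ _ in Icc (0 : ℝ) 1, ENNReal.ofReal ℓ := by
          refine lintegral_mono fun s => ENNReal.ofReal_le_ofReal ?_
          rw [← Complex.norm_eq_sqrt_sq_add_sq]
          exact hℓ s
      _ = ENNReal.ofReal ℓ := by simp

/-- The horizontal lift, starting from `p`, of the line `s ↦ p.1 + s v`. -/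
noncomputable def segLift (m : ℝ) (p : ℂ × ℝ) (v : ℂ) (s : ℝ) : ℂ × ℝ :=
  (p.1 + s * v, p.2 + ∫ u in (0 : ℝ)..s, eta m (p.1 + u * v) v)

theorem segLift_zero (m : ℝ) (p : ℂ × ℝ) (v : ℂ) : segLift m p v 0 = p := by
  simp [segLift]

theorem hasDerivAt_segLift {m : ℝ} (hm : 1 ≤ m) (p : ℂ × ℝ) (v : ℂ) (s : ℝ) :
    HasDerivAt (segLift m p v) (v, eta m (segLift m p v s).1 v) s := by
  have h1 : HasDerivAt (fun s : ℝ => p.1 + s * v) v s := by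
    simpa using (((hasDerivAt_id s).ofReal_comp).mul_const v).const_add p.1
  have h2 : Continuous fun u : ℝ => eta m (p.1 + u * v) v :=
    ((continuous_eta hm).comp (by fun_prop)).clm_apply continuous_const
  exact h1.prodMk ((h2.integral_hasStrictDerivAt 0 s).hasDerivAt.const_add p.2)

theorem continuous_segLift {m : ℝ} (hm : 1 ≤ m) (p : ℂ × ℝ) (v : ℂ) :
    Continuous (segLift m p v) :=
  continuous_iff_continuousAt.2 fun s => (hasDerivAt_segLift hm p v s).continuousAt

theorem ccDist_segLift_le {m : ℝ} (hm : 1 ≤ m) (p : ℂ × ℝ) (v : ℂ) {s : ℝ} (hs : 0 ≤ s) :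
    ccDist m p (segLift m p v s) ≤ ENNReal.ofReal (s * ‖v‖) := by
  have h := ccDist_le_of_hasDerivAt hm (γ := fun x => segLift m p v (s * x))
    (c := fun _ => s * v) continuous_const (ℓ := s * ‖v‖) (fun x => ?_) (fun x => ?_)
  · simpa [segLift_zero] using h
  · have h1 := (hasDerivAt_segLift hm p v (s * x)).scomp x ((hasDerivAt_id x).const_mul s)
    refine h1.congr_deriv ?_
    refine Prod.ext (by simp) ?_
    simp only [mul_one, Prod.smul_mk]
    rw [← Complex.real_smul, map_smul]
  · simp [abs_of_nonneg hs]

theorem height_segLift_ge {m : ℝ} (hm : 1 ≤ m) {φ : ℂ → ℝ} (hφ : ContDiff ℝ 1 φ)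
    (p : ℂ × ℝ) (v : ℂ) {κ s : ℝ} (hs : 0 ≤ s)
    (h : ∀ u ∈ Icc 0 s, κ ≤ covec m φ (p.1 + u * v) v) :
    height φ p + κ * s ≤ height φ (segLift m p v s) := by
  have hd : ∀ u : ℝ, HasDerivAt (fun u => height φ (segLift m p v u))
      (covec m φ (p.1 + u * v) v) u := fun u => by
    refine ((hasFDerivAt_height hφ _).comp_hasDerivAt u (hasDerivAt_segLift hm p v u)).congr_deriv ?_
    simp [covec, segLift]
  have := (convex_Icc 0 s).mul_sub_le_image_sub_of_le_deriv (C := κ)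
    (f := fun u => height φ (segLift m p v u))
    (fun u _ => (hd u).continuousAt.continuousWithinAt)
    (fun u _ => (hd u).differentiableAt.differentiableWithinAt)
    (fun u hu => by rw [(hd u).deriv]; exact h u (interior_subset hu))
    0 ⟨le_rfl, hs⟩ s ⟨hs, le_rfl⟩ hs
  rw [segLift_zero] at this
  linarith

/-- Rays through the origin are horizontal. -/
theorem ccDist_radial_le {m : ℝ} (hm : 1 ≤ m) (e : ℂ) (he : ‖e‖ = 1) (x y t : ℝ) :
    ccDist m (x * e, t) (y * e, t) ≤ ENNReal.ofReal |y - x| := by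
  have h := ccDist_le_of_hasDerivAt hm (γ := fun u : ℝ => ((x + u * (y - x) : ℝ) * e, t))
    (c := fun _ => ((y - x : ℝ) : ℂ) * e) continuous_const (ℓ := |y - x|) (fun u => ?_)
    (fun u => by rw [norm_mul, he, Complex.norm_real, Real.norm_eq_abs, mul_one])
  · simpa using h
  · refine HasDerivAt.prodMk ?_ ?_
    · have := ((((hasDerivAt_id u).mul_const (y - x)).const_add x).ofReal_comp).mul_const e
      simpa using this
    · refine (hasDerivAt_const u t).congr_deriv ?_
      rw [eta_apply]
      simp only [Complex.re_ofReal_mul, Complex.im_ofReal_mul]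
      ring

/-- Along a circle centered at the origin the horizontal lift has constant vertical speed. -/
theorem ccDist_arc_le {m : ℝ} (hm : 1 ≤ m) (z : ℂ) (t α : ℝ) :
    ccDist m (z, t) (z * Complex.exp (α * Complex.I), t - α * (‖z‖ ^ (2 * m) * ‖z‖ ^ 2))
      ≤ ENNReal.ofReal (|α| * ‖z‖) := by
  have hn : ∀ u : ℝ, ‖z * Complex.exp ((u * α : ℝ) * Complex.I)‖ = ‖z‖ := fun u => by
    rw [norm_mul, Complex.norm_exp_ofReal_mul_I, mul_one]
  have h := ccDist_le_of_hasDerivAt hm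
    (γ := fun u : ℝ => (z * Complex.exp ((u * α : ℝ) * Complex.I),
      t - (u * α) * (‖z‖ ^ (2 * m) * ‖z‖ ^ 2)))
    (c := fun u : ℝ => (α * Complex.I) * (z * Complex.exp ((u * α : ℝ) * Complex.I)))
    (by fun_prop) (ℓ := |α| * ‖z‖) (fun u => ?_) (fun u => ?_)
  · simpa using h
  · refine HasDerivAt.prodMk ?_ ?_
    · have := (((((hasDerivAt_id u).mul_const α).ofReal_comp).mul_const Complex.I).cexp).const_mul z
      refine this.congr_deriv ?_
      simp only [id]; push_cast; ring
    · have := (((hasDerivAt_id u).mul_const α).mul_const (‖z‖ ^ (2 * m) * ‖z‖ ^ 2)).const_sub t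
      refine this.congr_deriv ?_
      rw [eta_apply, hn u]
      have h2 := hn u
      rw [Complex.norm_eq_sqrt_sq_add_sq, Real.sqrt_eq_iff_mul_self_eq (by positivity)
        (norm_nonneg _)] at h2
      set w := z * Complex.exp ((u * α : ℝ) * Complex.I)
      rw [pow_two, ← h2]
      simp only [Complex.mul_re, Complex.mul_im, Complex.ofReal_re, Complex.ofReal_im,
        Complex.I_re, Complex.I_im]
      ring
  · rw [norm_mul, hn u]; simp

/-- Points on a vertical line are joined by a loop which runs out along a ray, along an arc, back
along a ray, and back along an arc of the original radius. -/
theorem ccDist_vertical_le {m : ℝ} (hm : 1 ≤ m) (z : ℂ) (t t' : ℝ) {s : ℝ} (hs : 0 ≤ s)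
    (h : |t' - t| ≤ s * lam m z s) : ccDist m (z, t) (z, t') ≤ ENNReal.ofReal (4 * s) := by
  rcases hs.eq_or_lt with rfl | hs
  · have : t' = t := by simpa [sub_eq_zero] using h
    rw [this, ccDist_self]; exact zero_le
  obtain ⟨e, he, hz⟩ : ∃ e : ℂ, ‖e‖ = 1 ∧ z = (‖z‖ : ℝ) * e := by
    rcases eq_or_ne z 0 with rfl | hz
    · exact ⟨1, by simp, by simp⟩
    · have : (‖z‖ : ℂ) ≠ 0 := by simpa using hz
      refine ⟨z / ‖z‖, by simp [hz], by field_simp⟩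
  set ρ := ‖z‖ with hρ
  have hρ0 : 0 ≤ ρ := norm_nonneg z
  have hσ : 0 < ρ + s := by linarith
  set Δ := (ρ + s) ^ (2 * m) * (ρ + s) ^ 2 - ρ ^ (2 * m) * ρ ^ 2 with hΔ
  have hP : 0 < (ρ + s) ^ (2 * m) := by positivity
  have hΔ1 : (ρ + s) ^ (2 * m) * (s * (ρ + s)) ≤ Δ := by
    have h1 : ρ ^ (2 * m) ≤ (ρ + s) ^ (2 * m) :=
      Real.rpow_le_rpow hρ0 (by linarith) (by linarith)
    have h2 := mul_le_mul_of_nonneg_right h1 (sq_nonneg ρ)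
    have h3 : 0 ≤ (ρ + s) ^ (2 * m) * (ρ * s) := by positivity
    rw [hΔ]; nlinarith
  have hΔ0 : 0 < Δ := lt_of_lt_of_le (by positivity) hΔ1
  -- the angle for which the loop closes up with the prescribed vertical gap
  set α := (t' - t) / Δ with hα
  have hα1 : |α| * (ρ + s) ≤ s := by
    rw [hα, abs_div, abs_of_pos hΔ0, div_mul_eq_mul_div, div_le_iff₀ hΔ0]
    calc |t' - t| * (ρ + s) ≤ s * lam m z s * (ρ + s) := by gcongr
      _ = s * ((ρ + s) ^ (2 * m) * (s * (ρ + s))) := by rw [lam]; ring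
      _ ≤ s * Δ := by gcongr
  have hα2 : |α| * ρ ≤ s := le_trans (by gcongr; linarith) hα1
  set e' := e * Complex.exp ((-α : ℝ) * Complex.I) with he'
  have hne' : ‖e'‖ = 1 := by rw [he', norm_mul, he, Complex.norm_exp_ofReal_mul_I, mul_one]
  have hnσ : ‖((ρ + s : ℝ) : ℂ) * e‖ = ρ + s := by
    rw [norm_mul, he, Complex.norm_real, Real.norm_of_nonneg hσ.le, mul_one]
  have hnρ : ‖(ρ : ℂ) * e'‖ = ρ := by
    rw [norm_mul, hne', Complex.norm_real, Real.norm_of_nonneg hρ0, mul_one]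
  have d1 := ccDist_radial_le hm e he ρ (ρ + s) t
  have d2 := ccDist_arc_le hm ((ρ + s : ℝ) * e) t (-α)
  have d3 := ccDist_radial_le hm e' hne' (ρ + s) ρ (t - -α * ((ρ + s) ^ (2 * m) * (ρ + s) ^ 2))
  have d4 := ccDist_arc_le hm (ρ * e') (t - -α * ((ρ + s) ^ (2 * m) * (ρ + s) ^ 2)) α
  rw [← hz, add_sub_cancel_left, abs_of_pos hs] at d1
  rw [hnσ, mul_assoc, ← he', abs_neg] at d2
  rw [show ρ - (ρ + s) = -s by ring, abs_neg, abs_of_pos hs] at d3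
  have hend : (ρ * e' * Complex.exp (α * Complex.I),
      t - -α * ((ρ + s) ^ (2 * m) * (ρ + s) ^ 2) - α * (ρ ^ (2 * m) * ρ ^ 2)) = (z, t') := by
    refine Prod.ext ?_ ?_
    · change ρ * e' * Complex.exp (α * Complex.I) = z
      rw [he', mul_assoc, mul_assoc, ← Complex.exp_add]
      simp [← hz]
    · have : α * Δ = t' - t := div_mul_cancel₀ _ hΔ0.ne'
      rw [hΔ] at this
      dsimp only
      linarith
  rw [hnρ, hend] at d4
  calc ccDist m (z, t) (z, t') ≤ _ := ccDist_triangle _ _ _ _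
    _ ≤ _ := add_le_add d1 (ccDist_triangle _ _ _ _)
    _ ≤ _ := add_le_add le_rfl (add_le_add d2 (ccDist_triangle _ _ _ _))
    _ ≤ _ := add_le_add le_rfl (add_le_add le_rfl (add_le_add d3 d4))
    _ ≤ ENNReal.ofReal (4 * s) := by
      rw [← ENNReal.ofReal_add (by positivity) (by positivity),
        ← ENNReal.ofReal_add (by positivity) (by positivity),
        ← ENNReal.ofReal_add (by positivity) (by positivity)]
      exact ENNReal.ofReal_le_ofReal (by linarith)

theorem ccDist_ne_top {m : ℝ} (hm : 1 ≤ m) (p q : ℂ × ℝ) : ccDist m p q ≠ ⊤ := by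
  have h1 := ccDist_segLift_le hm p (q.1 - p.1) zero_le_one
  set x := segLift m p (q.1 - p.1) 1 with hx
  have hx1 : x.1 = q.1 := by simp [hx, segLift]
  set s := 1 + |q.2 - x.2| with hs
  have hs1 : 1 ≤ s := by have := abs_nonneg (q.2 - x.2); linarith
  have h2 := ccDist_vertical_le hm q.1 x.2 q.2 (s := s) (by linarith) (by
    have h3 : 1 ≤ (‖q.1‖ + s) ^ (2 * m) :=
      Real.one_le_rpow (by linarith [norm_nonneg q.1]) (by linarith)
    have h4 : s * 1 ≤ s * (‖q.1‖ + s) ^ (2 * m) := by gcongr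
    have h5 : 1 * (s * 1) ≤ s * (s * (‖q.1‖ + s) ^ (2 * m)) :=
      mul_le_mul hs1 h4 (by linarith) (by linarith)
    rw [lam]
    linarith)
  rw [show (q.1, x.2) = x from Prod.ext hx1.symm rfl] at h2
  exact ne_top_of_le_ne_top (ENNReal.add_ne_top.2 ⟨ENNReal.ofReal_ne_top, ENNReal.ofReal_ne_top⟩)
    ((ccDist_triangle m p x q).trans (add_le_add h1 h2))

/-! ### John arcs and their concatenation -/

/-- There is a curve in `Ω` from `p` to `x` which stays at distance at most `D` from `p` and whose
points are the centers of balls in `Ω` of radius `ε` times the diameter of the arc from `p`. -/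
def JohnArc (m : ℝ) (Ω : Set (ℂ × ℝ)) (ε D : ℝ) (p x : ℂ × ℝ) : Prop :=
  ∃ γ : ℝ → ℂ × ℝ, ContinuousOn γ (Icc 0 1) ∧ γ 0 = p ∧ γ 1 = x ∧ ∀ t ∈ Icc (0 : ℝ) 1,
    γ t ∈ Ω ∧ ccDist m p (γ t) ≤ ENNReal.ofReal D ∧
      ccBall m (γ t) (ENNReal.ofReal ε * ccDiam m (γ '' Icc 0 t)) ⊆ Ω

/-- The concatenation of two curves on `[0, 1]`. -/
noncomputable def curveTrans (γ₁ γ₂ : ℝ → ℂ × ℝ) (s : ℝ) : ℂ × ℝ :=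
  if s ≤ 1 / 2 then γ₁ (2 * s) else γ₂ (2 * s - 1)

theorem curveTrans_of_le {γ₁ γ₂ : ℝ → ℂ × ℝ} {s : ℝ} (h : s ≤ 1 / 2) :
    curveTrans γ₁ γ₂ s = γ₁ (2 * s) := if_pos h

theorem curveTrans_of_lt {γ₁ γ₂ : ℝ → ℂ × ℝ} {s : ℝ} (h : 1 / 2 < s) :
    curveTrans γ₁ γ₂ s = γ₂ (2 * s - 1) := if_neg h.not_ge

theorem continuousOn_curveTrans {γ₁ γ₂ : ℝ → ℂ × ℝ} (h₁ : ContinuousOn γ₁ (Icc 0 1))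
    (h₂ : ContinuousOn γ₂ (Icc 0 1)) (h : γ₁ 1 = γ₂ 0) :
    ContinuousOn (curveTrans γ₁ γ₂) (Icc 0 1) := by
  have hu : Icc (0 : ℝ) 1 = Icc 0 (1 / 2) ∪ Icc (1 / 2) 1 :=
    (Icc_union_Icc_eq_Icc (by norm_num) (by norm_num)).symm
  rw [hu]
  refine ContinuousOn.union_of_isClosed ?_ ?_ isClosed_Icc isClosed_Icc
  · refine (h₁.comp (f := fun s => 2 * s) (by fun_prop) ?_).congr fun s hs => ?_
    · intro s hs; constructor <;> dsimp only <;> linarith [hs.1, hs.2]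
    · exact curveTrans_of_le hs.2
  · refine (h₂.comp (f := fun s => 2 * s - 1) (by fun_prop) ?_).congr fun s hs => ?_
    · intro s hs; constructor <;> dsimp only <;> linarith [hs.1, hs.2]
    · rcases hs.1.eq_or_lt with rfl | h1
      · rw [curveTrans_of_le le_rfl]; norm_num [h]
      · exact curveTrans_of_lt h1

theorem image_curveTrans_of_le {γ₁ γ₂ : ℝ → ℂ × ℝ} {t : ℝ} (h : t ≤ 1 / 2) :
    curveTrans γ₁ γ₂ '' Icc 0 t ⊆ γ₁ '' Icc 0 (2 * t) := by
  rintro _ ⟨s, hs, rfl⟩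
  rw [curveTrans_of_le (hs.2.trans h)]
  exact ⟨2 * s, ⟨by linarith [hs.1], by linarith [hs.2]⟩, rfl⟩

theorem image_curveTrans_subset (γ₁ γ₂ : ℝ → ℂ × ℝ) (t : ℝ) :
    curveTrans γ₁ γ₂ '' Icc 0 t ⊆ γ₁ '' Icc 0 1 ∪ γ₂ '' Icc 0 (2 * t - 1) := by
  rintro _ ⟨s, hs, rfl⟩
  rcases le_or_gt s (1 / 2) with h1 | h1
  · rw [curveTrans_of_le h1]
    exact Or.inl ⟨2 * s, ⟨by linarith [hs.1], by linarith [hs.2]⟩, rfl⟩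
  · rw [curveTrans_of_lt h1]
    exact Or.inr ⟨2 * s - 1, ⟨by linarith [hs.1], by linarith [hs.2]⟩, rfl⟩

theorem ccDiam_mono (m : ℝ) {S T : Set (ℂ × ℝ)} (h : S ⊆ T) : ccDiam m S ≤ ccDiam m T :=
  (biSup_mono h).trans (iSup₂_mono fun _ _ => biSup_mono h)

theorem ccDiam_le {m : ℝ} {S : Set (ℂ × ℝ)} (p : ℂ × ℝ) {D : ℝ} (hD : 0 ≤ D)
    (h : ∀ x ∈ S, ccDist m p x ≤ ENNReal.ofReal D) : ccDiam m S ≤ ENNReal.ofReal (2 * D) := by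
  refine iSup₂_le fun x hx => iSup₂_le fun y hy => ?_
  refine (ccDist_triangle m x p y).trans ?_
  rw [ccDist_comm m x p, two_mul, ENNReal.ofReal_add hD hD]
  exact add_le_add (h x hx) (h y hy)

theorem ccBall_mono (m : ℝ) (p : ℂ × ℝ) {r s : ℝ≥0∞} (h : r ≤ s) : ccBall m p r ⊆ ccBall m p s :=
  fun _ hx => lt_of_lt_of_le hx h

theorem JohnArc.mono {m : ℝ} {Ω : Set (ℂ × ℝ)} {ε D ε' D' : ℝ} {p x : ℂ × ℝ}
    (h : JohnArc m Ω ε D p x) (hε : ε' ≤ ε) (hD : D ≤ D') : JohnArc m Ω ε' D' p x := by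
  obtain ⟨γ, h1, h2, h3, h4⟩ := h
  refine ⟨γ, h1, h2, h3, fun t ht => ⟨(h4 t ht).1,
    (h4 t ht).2.1.trans (ENNReal.ofReal_le_ofReal hD),
    (ccBall_mono m _ ?_).trans (h4 t ht).2.2⟩⟩
  gcongr

theorem ofReal_mul_ccDiam_le {m ε D : ℝ} (hε : 0 ≤ ε) (hD : 0 ≤ D) {S : Set (ℂ × ℝ)}
    (p : ℂ × ℝ) (h : ∀ x ∈ S, ccDist m p x ≤ ENNReal.ofReal D) :
    ENNReal.ofReal ε * ccDiam m S ≤ ENNReal.ofReal (ε * (2 * D)) := by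
  rw [ENNReal.ofReal_mul hε]
  gcongr
  exact ccDiam_le p hD h

/-- A John arc may be continued by a curve around whose points `Ω` contains large enough balls. -/
theorem JohnArc.trans {m : ℝ} {Ω : Set (ℂ × ℝ)} {ε D : ℝ} (hε : 0 ≤ ε) (hD : 0 ≤ D)
    {p x : ℂ × ℝ} (h : JohnArc m Ω ε D p x) {γ₂ : ℝ → ℂ × ℝ} (hc : ContinuousOn γ₂ (Icc 0 1))
    (h0 : γ₂ 0 = x) {ρ : ℝ → ℝ} (hρ : MonotoneOn ρ (Icc 0 1)) (hDρ : D ≤ ρ 0)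
    (hγ : ∀ t ∈ Icc (0 : ℝ) 1, γ₂ t ∈ Ω ∧ ccDist m p (γ₂ t) ≤ ENNReal.ofReal (ρ t) ∧
      ccBall m (γ₂ t) (ENNReal.ofReal (ε * (2 * ρ t))) ⊆ Ω) :
    JohnArc m Ω ε (ρ 1) p (γ₂ 1) := by
  obtain ⟨γ₁, h1, h2, h3, h4⟩ := h
  have hρ0 : ∀ t ∈ Icc (0 : ℝ) 1, D ≤ ρ t := fun t ht =>
    hDρ.trans (hρ ⟨le_rfl, zero_le_one⟩ ht ht.1)
  refine ⟨curveTrans γ₁ γ₂, continuousOn_curveTrans h1 hc (h3.trans h0.symm), ?_, ?_,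
    fun t ht => ?_⟩
  · rw [curveTrans_of_le (by norm_num)]; simpa using h2
  · rw [curveTrans_of_lt (by norm_num)]; norm_num
  · rcases le_or_gt t (1 / 2) with ht2 | ht2
    · rw [curveTrans_of_le ht2]
      obtain ⟨h5, h6, h7⟩ := h4 (2 * t) ⟨by linarith [ht.1], by linarith⟩
      refine ⟨h5, h6.trans (ENNReal.ofReal_le_ofReal (hρ0 1 (by simp))),
        (ccBall_mono m _ ?_).trans h7⟩
      gcongr
      exact ccDiam_mono m (image_curveTrans_of_le ht2)
    · have ht' : 2 * t - 1 ∈ Icc (0 : ℝ) 1 := ⟨by linarith, by linarith [ht.2]⟩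
      rw [curveTrans_of_lt ht2]
      obtain ⟨h5, h6, h7⟩ := hγ _ ht'
      refine ⟨h5, h6.trans (ENNReal.ofReal_le_ofReal (hρ ht' (by simp) ht'.2)),
        (ccBall_mono m _ ?_).trans h7⟩
      refine ofReal_mul_ccDiam_le hε (hD.trans (hρ0 _ ht')) p fun y hy => ?_
      rcases image_curveTrans_subset _ _ _ hy with ⟨s, hs, rfl⟩ | ⟨s, hs, rfl⟩
      · exact (h4 s hs).2.1.trans (ENNReal.ofReal_le_ofReal (hρ0 _ ht'))
      · have hs' : s ∈ Icc (0 : ℝ) 1 := ⟨hs.1, hs.2.trans ht'.2⟩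
        exact (hγ s hs').2.1.trans (ENNReal.ofReal_le_ofReal (hρ hs' ht' hs.2))

/-- Two John arcs with the same end point form a curve as in the definition of uniform domains. -/
theorem JohnArc.exists_curve {m : ℝ} {Ω : Set (ℂ × ℝ)} {ε D : ℝ} (hD : 0 ≤ D)
    {p q x : ℂ × ℝ} (hp : JohnArc m Ω ε D p x) (hq : JohnArc m Ω ε D q x) :
    ∃ γ : ℝ → ℂ × ℝ, ContinuousOn γ (Icc 0 1) ∧ MapsTo γ (Icc 0 1) Ω ∧ γ 0 = p ∧ γ 1 = q ∧
      ccDiam m (γ '' Icc 0 1) ≤ ENNReal.ofReal (4 * D) ∧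
      ∀ t ∈ Icc (0 : ℝ) 1,
        ccBall m (γ t)
          (ENNReal.ofReal ε * min (ccDiam m (γ '' Icc 0 t)) (ccDiam m (γ '' Icc t 1))) ⊆ Ω := by
  obtain ⟨γ₁, h1, h2, h3, h4⟩ := hp
  obtain ⟨γ₂, k1, k2, k3, k4⟩ := hq
  have hmaps : ∀ s ∈ Icc (0 : ℝ) 1, 1 - s ∈ Icc (0 : ℝ) 1 := fun s hs =>
    ⟨by linarith [hs.2], by linarith [hs.1]⟩
  refine ⟨curveTrans γ₁ fun s => γ₂ (1 - s), continuousOn_curveTrans h1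
    (k1.comp (by fun_prop) hmaps) (by simp [h3, k3]), fun t ht => ?_, ?_, ?_, ?_, fun t ht => ?_⟩
  · rcases le_or_gt t (1 / 2) with ht2 | ht2
    · rw [curveTrans_of_le ht2]
      exact (h4 _ ⟨by linarith [ht.1], by linarith⟩).1
    · rw [curveTrans_of_lt ht2]
      exact (k4 _ ⟨by linarith [ht.2], by linarith⟩).1
  · rw [curveTrans_of_le (by norm_num)]; simpa using h2
  · rw [curveTrans_of_lt (by norm_num)]; norm_num [k2]
  · have hx : ∀ y, ccDist m y x ≤ ENNReal.ofReal D → ∀ w, ccDist m y w ≤ ENNReal.ofReal D →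
        ccDist m x w ≤ ENNReal.ofReal (2 * D) := fun y hy w hw => by
      refine (ccDist_triangle m x y w).trans ?_
      rw [ccDist_comm m x y, two_mul, ENNReal.ofReal_add hD hD]
      exact add_le_add hy hw
    rw [show 4 * D = 2 * (2 * D) by ring]
    refine ccDiam_le x (by positivity) fun y hy => ?_
    have hpx := (h4 1 (by simp)).2.1
    have hqx := (k4 1 (by simp)).2.1
    rw [h3] at hpx
    rw [k3] at hqx
    rcases image_curveTrans_subset _ _ _ hy with ⟨s, hs, rfl⟩ | ⟨s, hs, rfl⟩
    · exact hx p hpx _ (h4 s hs).2.1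
    · exact hx q hqx _ (k4 _ (hmaps s ⟨hs.1, by linarith [hs.2]⟩)).2.1
  · rcases le_or_gt t (1 / 2) with ht2 | ht2
    · rw [curveTrans_of_le ht2]
      refine (ccBall_mono m _ ?_).trans (h4 (2 * t) ⟨by linarith [ht.1], by linarith⟩).2.2
      gcongr
      exact (min_le_left _ _).trans (ccDiam_mono m (image_curveTrans_of_le ht2))
    · rw [curveTrans_of_lt ht2]
      refine (ccBall_mono m _ ?_).trans
        (k4 (1 - (2 * t - 1)) ⟨by linarith [ht.2], by linarith⟩).2.2
      gcongr
      refine (min_le_right _ _).trans (ccDiam_mono m ?_)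
      rintro _ ⟨s, hs, rfl⟩
      rw [curveTrans_of_lt (ht2.trans_le hs.1)]
      exact ⟨1 - (2 * s - 1), ⟨by linarith [hs.2], by linarith [hs.1]⟩, rfl⟩

/-! ### John arcs in epigraphs -/

theorem ccDist_add_le {m : ℝ} {p q x : ℂ × ℝ} {a b : ℝ} (ha : 0 ≤ a) (hb : 0 ≤ b)
    (h1 : ccDist m p q ≤ ENNReal.ofReal a) (h2 : ccDist m q x ≤ ENNReal.ofReal b) :
    ccDist m p x ≤ ENNReal.ofReal (a + b) := by
  rw [ENNReal.ofReal_add ha hb]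
  exact (ccDist_triangle m p q x).trans (add_le_add h1 h2)

theorem mem_epi_iff {φ : ℂ → ℝ} {p : ℂ × ℝ} : p ∈ epi φ ↔ 0 < height φ p := by
  simp [epi, height]

theorem HasCovecBound.ccBall_subset_epi {m C : ℝ} (hm : 1 ≤ m) (hC : 0 ≤ C) {φ : ℂ → ℝ}
    (hφ : HasCovecBound m C φ) {p : ℂ × ℝ} {ρ : ℝ}
    (h : ρ * (‖covec m φ p.1‖ + C * lam m p.1 ρ) < height φ p) :
    ccBall m p (ENNReal.ofReal ρ) ⊆ epi φ := by
  intro q hq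
  have := hφ.abs_height_sub_le hm hC hq
  rw [mem_epi_iff]
  linarith [neg_abs_le (height φ q - height φ p)]

/-- Moving horizontally in a direction of increasing height gives a John arc. -/
theorem HasCovecBound.johnArc_segLift {m C : ℝ} (hm : 1 ≤ m) (hC : 0 ≤ C) {φ : ℂ → ℝ}
    (hφ : HasCovecBound m C φ) {p : ℂ × ℝ} (hp : 0 < height φ p) {e : ℂ} (he : ‖e‖ = 1)
    {L κ B ε : ℝ} (hL : 0 ≤ L) (hκ : 0 ≤ κ) (hε : 0 ≤ ε) (hε1 : 2 * ε ≤ 1)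
    (hεB : 2 * ε * B ≤ κ)
    (h1 : ∀ s ∈ Icc 0 L, κ ≤ covec m φ (p.1 + s * e) e)
    (h2 : ∀ s ∈ Icc 0 L, ‖covec m φ (p.1 + s * e)‖ + C * lam m (p.1 + s * e) s ≤ B) :
    JohnArc m (epi φ) ε L p (segLift m p e L) := by
  refine ⟨fun x => segLift m p e (L * x), ?_, by simp [segLift_zero], by simp, fun x hx => ?_⟩
  · exact ((continuous_segLift hm p e).comp (by fun_prop)).continuousOn
  have hs : L * x ∈ Icc 0 L := ⟨mul_nonneg hL hx.1, mul_le_of_le_one_right hL hx.2⟩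
  have hd : ∀ y ∈ Icc (0 : ℝ) x, ccDist m p (segLift m p e (L * y)) ≤ ENNReal.ofReal (L * x) := by
    intro y hy
    refine (ccDist_segLift_le hm p e (mul_nonneg hL hy.1)).trans (ENNReal.ofReal_le_ofReal ?_)
    rw [he, mul_one]
    exact mul_le_mul_of_nonneg_left hy.2 hL
  have hh := height_segLift_ge hm hφ.contDiff p e hs.1
    (fun u hu => h1 u ⟨hu.1, hu.2.trans hs.2⟩)
  refine ⟨?_, (hd x ⟨hx.1, le_rfl⟩).trans (ENNReal.ofReal_le_ofReal hs.2), ?_⟩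
  · rw [mem_epi_iff]
    have := mul_nonneg hκ hs.1
    linarith
  refine (ccBall_mono m _ (ofReal_mul_ccDiam_le hε hs.1 p ?_)).trans
    (hφ.ccBall_subset_epi hm hC ?_)
  · rintro _ ⟨y, hy, rfl⟩; exact hd y hy
  · have hr : 0 ≤ ε * (2 * (L * x)) := by have := hs.1; positivity
    have hr2 : ε * (2 * (L * x)) ≤ L * x := by
      have := mul_le_mul_of_nonneg_right hε1 hs.1
      linarith
    have h3 := h2 _ hs
    have h4 := lam_le_lam hm (p.1 + (L * x : ℝ) * e) hr hr2
    calc ε * (2 * (L * x)) * (‖covec m φ (p.1 + (L * x : ℝ) * e)‖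
          + C * lam m (p.1 + (L * x : ℝ) * e) (ε * (2 * (L * x))))
        ≤ ε * (2 * (L * x)) * B := by
          refine mul_le_mul_of_nonneg_left (le_trans ?_ h3) hr
          gcongr
      _ = (2 * ε * B) * (L * x) := by ring
      _ ≤ κ * (L * x) := mul_le_mul_of_nonneg_right hεB hs.1
      _ < _ := by linarith

/-- A John arc may be continued vertically if the height dominates the variation of the height at
the scale of the arc. -/
theorem JohnArc.vertical {m C : ℝ} (hm : 1 ≤ m) (hC : 0 ≤ C) {φ : ℂ → ℝ}
    (hφ : HasCovecBound m C φ) {p x : ℂ × ℝ} {ε L S : ℝ} (hε : 0 ≤ ε) (hL : 0 ≤ L) (hS : 0 ≤ S)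
    (h : JohnArc m (epi φ) ε L p x)
    (h1 : ∀ s ∈ Icc 0 S, ε * (2 * (L + 4 * s)) *
      (‖covec m φ x.1‖ + C * lam m x.1 (ε * (2 * (L + 4 * s)))) < height φ x + s * lam m x.1 s) :
    JohnArc m (epi φ) ε (L + 4 * S) p (x.1, x.2 + S * lam m x.1 S) := by
  have hc : Continuous fun u => (x.1, x.2 + (S * u) * lam m x.1 (S * u)) := by
    unfold lam
    refine continuous_const.prodMk (continuous_const.add (Continuous.mul (by fun_prop)
      (Continuous.mul (by fun_prop) (Continuous.rpow_const (by fun_prop) fun _ => Or.inr ?_))))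
    linarith
  obtain ⟨γ, -, -, hγ1, hγ⟩ := id h
  have hx := (hγ 1 (by simp)).2.1
  rw [hγ1] at hx
  have := h.trans hε hL hc.continuousOn (by simp [lam]) (ρ := fun u => L + 4 * (S * u))
    (fun u _ v _ huv => by dsimp only; gcongr) (by simp) (fun u hu => ?_)
  · simpa using this
  have hs : S * u ∈ Icc 0 S := ⟨mul_nonneg hS hu.1, mul_le_of_le_one_right hS hu.2⟩
  have hpos : 0 ≤ L + 4 * (S * u) := by linarith [hs.1]
  have h2 := h1 _ hs
  have h3 : height φ (x.1, x.2 + S * u * lam m x.1 (S * u)) =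
      height φ x + S * u * lam m x.1 (S * u) := by simp only [height]; ring
  refine ⟨?_, ?_, hφ.ccBall_subset_epi hm hC (by rw [h3]; exact h2)⟩
  · rw [mem_epi_iff, h3]
    refine lt_of_le_of_lt ?_ h2
    have := lam_nonneg m x.1 (s := ε * (2 * (L + 4 * (S * u)))) (by positivity)
    positivity
  · refine ccDist_add_le hL (by linarith [hs.1]) hx
      (ccDist_vertical_le hm x.1 x.2 _ hs.1 ?_)
    rw [add_sub_cancel_left, abs_of_nonneg (mul_nonneg hs.1 (lam_nonneg m _ hs.1))]

/-- Two points of large height are joined at large height by a horizontal lift of a segment and a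
vertical segment. The vertical gap is controlled by the distance of the two points. -/
theorem JohnArc.connect {m C : ℝ} (hm : 1 ≤ m) (hC : 0 ≤ C) {φ : ℂ → ℝ}
    (hφ : HasCovecBound m C φ) {p x y : ℂ × ℝ} {ε D E ℓ r b D' : ℝ} (hε : 0 ≤ ε) (hD : 0 ≤ D)
    (hE : 0 ≤ E) (hr : 0 < r) (hb : 0 < b) (h : JohnArc m (epi φ) ε D p x)
    (hy : ccDist m p y ≤ ENNReal.ofReal E) (hℓ : ‖y.1 - x.1‖ ≤ ℓ)
    (hbw : ∀ s ∈ Icc (0 : ℝ) 1, ‖covec m φ (x.1 + s * (y.1 - x.1))‖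
      + C * lam m (x.1 + s * (y.1 - x.1)) r ≤ b)
    (hhx : b * (ℓ + r) ≤ height φ x) (hhy : b * (ℓ + r) ≤ height φ y)
    (hD' : D' = D + ℓ + 4 * ((2 * m + 1) * (ℓ + D + E + r))) (hε' : ε * (2 * D') < r) :
    JohnArc m (epi φ) ε D' p y := by
  set v := y.1 - x.1 with hv
  have hℓ0 : 0 ≤ ℓ := (norm_nonneg _).trans hℓ
  set R := ℓ + D + E + r with hR
  have hR0 : 0 < R := by positivity
  have hk : 1 ≤ 2 * m + 1 := by linarith
  have hk0 : 0 < 2 * m + 1 := by linarith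
  have hD0 : 0 ≤ D' := by rw [hD']; positivity
  obtain ⟨γ, -, -, hγ1, hγ⟩ := id h
  have hx := (hγ 1 (by simp)).2.1
  rw [hγ1] at hx
  have hseg : ∀ s ∈ Icc (0 : ℝ) 1, ccDist m x (segLift m x v s) ≤ ENNReal.ofReal ℓ :=
    fun s hs => (ccDist_segLift_le hm x v hs.1).trans (ENNReal.ofReal_le_ofReal
      ((mul_le_of_le_one_left (norm_nonneg _) hs.2).trans hℓ))
  -- every point of height at least `b * r` over the segment is the center of a large ball
  have hsafe : ∀ w : ℂ × ℝ, (∃ s ∈ Icc (0 : ℝ) 1, w.1 = x.1 + s * v) → b * r ≤ height φ w →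
      w ∈ epi φ ∧ ccBall m w (ENNReal.ofReal (ε * (2 * D'))) ⊆ epi φ := by
    rintro w ⟨s, hs, hw⟩ hh
    refine ⟨mem_epi_iff.2 (lt_of_lt_of_le (by positivity) hh), hφ.ccBall_subset_epi hm hC ?_⟩
    have h1 : 0 ≤ ε * (2 * D') := by positivity
    have h2 := lam_le_lam hm w.1 h1 hε'.le
    have h3 := hbw s hs
    rw [← hw] at h3
    calc ε * (2 * D') * (‖covec m φ w.1‖ + C * lam m w.1 (ε * (2 * D')))
        ≤ ε * (2 * D') * b := by
          refine mul_le_mul_of_nonneg_left (le_trans ?_ h3) h1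
          gcongr
      _ < r * b := by gcongr
      _ ≤ _ := by linarith
  have hhseg : ∀ s ∈ Icc (0 : ℝ) 1, b * r ≤ height φ (segLift m x v s) := by
    intro s hs
    have h1 := height_segLift_ge hm hφ.contDiff x v (κ := -(b * ℓ)) hs.1 fun u hu => by
      have h2 := hbw u ⟨hu.1, hu.2.trans hs.2⟩
      have h3 := (covec m φ (x.1 + u * v)).le_opNorm v
      have h4 := lam_nonneg m (x.1 + u * v) hr.le
      rw [Real.norm_eq_abs] at h3
      have h5 : ‖covec m φ (x.1 + u * v)‖ * ‖v‖ ≤ b * ℓ := by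
        gcongr
        have := mul_nonneg hC h4
        linarith
      linarith [neg_abs_le (covec m φ (x.1 + u * v) v)]
    have h2 : b * ℓ * s ≤ b * ℓ := mul_le_of_le_one_right (by positivity) hs.2
    linarith
  set y' := segLift m x v 1 with hy'
  have hy1 : y'.1 = y.1 := by simp [hy', segLift, hv]
  have harc := h.trans hε hD (continuous_segLift hm x v).continuousOn (segLift_zero m x v)
    (ρ := fun _ => D') (fun _ _ _ _ _ => le_rfl)
    (by rw [hD']; linarith [mul_pos hk0 hR0]) fun s hs => by
      obtain ⟨h1, h2⟩ := hsafe (segLift m x v s) ⟨s, hs, rfl⟩ (hhseg s hs)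
      refine ⟨h1, (ccDist_add_le hD hℓ0 hx (hseg s hs)).trans (ENNReal.ofReal_le_ofReal ?_), h2⟩
      rw [hD']; linarith [mul_pos hk0 hR0]
  have hpy' : ccDist m p y' ≤ ENNReal.ofReal (D + ℓ) :=
    ccDist_add_le hD hℓ0 hx (hseg 1 (by simp))
  -- the vertical gap
  have hgap : |y.2 - y'.2| ≤ (2 * m + 1) * R * lam m y.1 ((2 * m + 1) * R) := by
    have h1 : ccDist m y' y ≤ ENNReal.ofReal (D + ℓ + E) :=
      ccDist_add_le (by positivity) hE ((ccDist_comm m y' p).trans_le hpy') hy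
    have h2 : ccDist m (y.1, y'.2) (y.1, y.2) < ENNReal.ofReal R := by
      rw [show (y.1, y'.2) = y' from Prod.ext hy1.symm rfl]
      refine h1.trans_lt ((ENNReal.ofReal_lt_ofReal_iff hR0).2 ?_)
      rw [hR]; linarith
    refine (abs_snd_sub_le_of_ccDist_lt hm h2).trans ?_
    have h3 : lam m y.1 R ≤ lam m y.1 ((2 * m + 1) * R) :=
      lam_le_lam hm _ hR0.le (le_mul_of_one_le_left hR0.le hk)
    calc (2 * m + 1) * (R * lam m y.1 R) = (2 * m + 1) * R * lam m y.1 R := by ring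
      _ ≤ _ := by gcongr
  have hfin := harc.trans hε hD0 (γ₂ := fun u => (y.1, y'.2 + u * (y.2 - y'.2)))
    (by fun_prop) (Prod.ext hy1.symm (by simp [hy'])) (ρ := fun _ => D')
    (fun _ _ _ _ _ => le_rfl) le_rfl fun u hu => by
      obtain ⟨h1, h2⟩ := hsafe (y.1, y'.2 + u * (y.2 - y'.2)) ⟨1, by simp, by simp [hv]⟩ (by
        have h3 := hhseg 1 (by simp)
        rw [← hy'] at h3
        have h4 : b * r ≤ height φ y := by
          have := mul_nonneg hb.le hℓ0
          linarith
        simp only [height, hy1] at h3 h4 ⊢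
        have h5 := mul_le_mul_of_nonneg_left h3 (sub_nonneg.2 hu.2)
        have h6 := mul_le_mul_of_nonneg_left h4 hu.1
        linarith)
      refine ⟨h1, ?_, h2⟩
      rw [hD']
      refine ccDist_add_le (by positivity) (by positivity) hpy' ?_
      have h3 := ccDist_vertical_le hm y.1 y'.2 (y'.2 + u * (y.2 - y'.2))
        (s := (2 * m + 1) * R) (by positivity) (by
          rw [add_sub_cancel_left, abs_mul, abs_of_nonneg hu.1]
          exact (mul_le_of_le_one_left (abs_nonneg _) hu.2).trans hgap)
      rwa [show (y.1, y'.2) = y' from Prod.ext hy1.symm rfl] at h3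
  simpa using hfin

/-! ### The two regimes -/

theorem exists_norm_eq_one_apply_eq_norm (T : ℂ →L[ℝ] ℝ) : ∃ e : ℂ, ‖e‖ = 1 ∧ T e = ‖T‖ := by
  obtain ⟨g, rfl⟩ := (InnerProductSpace.toDual ℝ ℂ).surjective T
  rcases eq_or_ne g 0 with rfl | hg
  · exact ⟨1, by simp, by simp⟩
  · have hg' : ‖g‖ ≠ 0 := by simpa using hg
    refine ⟨(‖g‖⁻¹ : ℝ) • g, by rw [norm_smul]; simp [hg'], ?_⟩
    rw [map_smul, LinearIsometryEquiv.norm_map, InnerProductSpace.toDual_apply_apply,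
      real_inner_self_eq_norm_mul_norm, smul_eq_mul]
    field_simp

/-- The noncharacteristic regime: if the horizontal gradient at `p` dominates its oscillation at
scale `r`, both points move horizontally in the direction of the horizontal gradient at `p`. -/
theorem HasCovecBound.exists_johnArcs_of_large {m C : ℝ} (hm : 1 ≤ m) (hC : 1 ≤ C) {φ : ℂ → ℝ}
    (hφ : HasCovecBound m C φ) {p q : ℂ × ℝ} (hp : p ∈ epi φ) (hq : q ∈ epi φ) {r ε : ℝ}
    (hr : 0 < r) (hpq : ccDist m p q < ENNReal.ofReal r)
    (hlarge : 40 * C * 9 ^ (2 * m) * lam m p.1 r ≤ ‖covec m φ p.1‖) (hε : 0 ≤ ε)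
    (hεm : ε * (200 * (2 * m + 1)) ≤ 1) :
    ∃ x, JohnArc m (epi φ) ε (50 * (2 * m + 1) * r) p x ∧
      JohnArc m (epi φ) ε (50 * (2 * m + 1) * r) q x := by
  set a := ‖covec m φ p.1‖ with ha
  set R := ‖p.1‖ + r with hR
  have hR0 : 0 < R := by have := norm_nonneg p.1; positivity
  have hrR : r ≤ R := by have := norm_nonneg p.1; linarith
  -- the constants: all points involved lie within `5 r` of `p`, and all scales are at most `4 r`
  set U := (9 * R) ^ (2 * m) with hU
  have hU0 : 0 < U := by positivity
  have hUa : 40 * C * (r * U) ≤ a := by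
    rw [hU, Real.mul_rpow (by norm_num) hR0.le]
    rw [lam] at hlarge
    linarith
  have ha0 : 0 < a := lt_of_lt_of_le (by positivity) hUa
  have hk : 3 ≤ 2 * m + 1 := by linarith
  have hε1 : ε * 600 ≤ 1 := by nlinarith
  obtain ⟨e, he, hae⟩ := exists_norm_eq_one_apply_eq_norm (covec m φ p.1)
  have hqp : ‖q.1 - p.1‖ ≤ r := fst_sub_le_of_ccDist_lt hpq
  have hosc : ∀ w : ℂ, ‖w - p.1‖ ≤ 5 * r → ‖covec m φ w - covec m φ p.1‖ ≤ a / 8 := by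
    intro w hw
    have h1 : lam m p.1 ‖w - p.1‖ ≤ 5 * r * U :=
      lam_mono hm (norm_nonneg _) hw (by linarith [norm_nonneg p.1])
    calc _ ≤ C * lam m p.1 ‖w - p.1‖ := hφ.bound _ _
      _ ≤ C * (5 * r * U) := by gcongr
      _ ≤ a / 8 := by linarith
  have hlam : ∀ w : ℂ, ‖w - p.1‖ ≤ 5 * r → ∀ s, 0 ≤ s → s ≤ 4 * r → C * lam m w s ≤ a / 8 := by
    intro w hw s hs0 hs
    have h1 : lam m w s ≤ 4 * r * U :=
      lam_mono hm hs0 hs (by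
        have : ‖w‖ ≤ ‖p.1‖ + ‖w - p.1‖ := norm_le_norm_add_norm_sub' w p.1
        linarith [norm_nonneg p.1])
    have h2 : 0 ≤ C * (r * U) := by positivity
    calc C * lam m w s ≤ C * (4 * r * U) := by gcongr
      _ ≤ a / 8 := by linarith
  have hB : ∀ w : ℂ, ‖w - p.1‖ ≤ 5 * r → ∀ s, 0 ≤ s → s ≤ 4 * r →
      ‖covec m φ w‖ + C * lam m w s ≤ 5 / 4 * a := by
    intro w hw s hs0 hs
    have h1 := hosc w hw
    have h2 := hlam w hw s hs0 hs
    have h3 := norm_le_norm_add_norm_sub' (covec m φ w) (covec m φ p.1)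
    linarith
  have hκ : ∀ w : ℂ, ‖w - p.1‖ ≤ 5 * r → 7 / 8 * a ≤ covec m φ w e := by
    intro w hw
    have h1 := (covec m φ w - covec m φ p.1).le_opNorm e
    rw [he, mul_one, Real.norm_eq_abs, sub_apply, hae] at h1
    linarith [neg_abs_le (covec m φ w e - a), hosc w hw]
  have hstep : ∀ x : ℂ × ℝ, x ∈ epi φ → ‖x.1 - p.1‖ ≤ r →
      JohnArc m (epi φ) ε (4 * r) x (segLift m x e (4 * r)) ∧
      7 / 2 * (a * r) ≤ height φ (segLift m x e (4 * r)) ∧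
      ccDist m x (segLift m x e (4 * r)) ≤ ENNReal.ofReal (4 * r) := by
    intro x hx hxp
    have hw : ∀ s ∈ Icc 0 (4 * r), ‖x.1 + s * e - p.1‖ ≤ 5 * r := by
      intro s hs
      calc ‖x.1 + s * e - p.1‖ = ‖(x.1 - p.1) + s * e‖ := by congr 1; ring
        _ ≤ ‖x.1 - p.1‖ + ‖(s : ℂ) * e‖ := norm_add_le _ _
        _ ≤ r + 4 * r := by
          rw [norm_mul, he, mul_one, Complex.norm_real, Real.norm_of_nonneg hs.1]
          linarith [hs.2]
        _ = 5 * r := by ring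
    rw [mem_epi_iff] at hx
    refine ⟨hφ.johnArc_segLift hm (by linarith) hx he (κ := 7 / 8 * a) (B := 5 / 4 * a)
      (by positivity) (by positivity) hε (by linarith) (by nlinarith)
      (fun s hs => hκ _ (hw s hs)) fun s hs => hB _ (hw s hs) s hs.1 hs.2, ?_, ?_⟩
    · have := height_segLift_ge hm hφ.contDiff x e (κ := 7 / 8 * a) (s := 4 * r) (by positivity)
        fun s hs => hκ _ (hw s hs)
      linarith
    · simpa [he] using ccDist_segLift_le hm x e (s := 4 * r) (by positivity)
  obtain ⟨jp, hhp, -⟩ := hstep p hp (by simpa using hr.le)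
  obtain ⟨jq, hhq, hdq⟩ := hstep q hq hqp
  have har : 0 < a * r := by positivity
  have hdiff : (segLift m q e (4 * r)).1 - (segLift m p e (4 * r)).1 = q.1 - p.1 := by
    simp [segLift]
  refine ⟨segLift m q e (4 * r), (jp.connect hm (by linarith) hφ (E := 5 * r) (ℓ := r) (r := r)
    (b := 5 / 4 * a) hε (by positivity) (by positivity) hr (by positivity) ?_ ?_ ?_
    (by linarith) (by linarith) rfl ?_).mono le_rfl ?_, jq.mono le_rfl ?_⟩
  · rw [show 5 * r = r + 4 * r by ring]
    exact ccDist_add_le hr.le (by positivity) hpq.le hdq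
  · rw [hdiff]; exact hqp
  · intro s hs
    refine hB _ ?_ r hr.le (by linarith)
    rw [hdiff]
    calc ‖(segLift m p e (4 * r)).1 + s * (q.1 - p.1) - p.1‖
        = ‖((4 * r : ℝ) : ℂ) * e + s * (q.1 - p.1)‖ := by
          congr 1; simp only [segLift]; ring
      _ ≤ 4 * r * 1 + 1 * r := by
          refine (norm_add_le _ _).trans ?_
          rw [norm_mul, norm_mul, he, Complex.norm_real, Complex.norm_real,
            Real.norm_of_nonneg hs.1, Real.norm_of_nonneg (by positivity)]
          gcongr
          exact hs.2
      _ = 5 * r := by ring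
  · nlinarith
  · nlinarith
  · nlinarith

/-- If the horizontal gradient at `p` is at most of the order of its oscillation at scale `r`, then
after a horizontal piece on which the gradient dominates its oscillation, the arc continues
vertically up to any multiple of the scale `r`. -/
theorem HasCovecBound.exists_climb {m C : ℝ} (hm : 1 ≤ m) (hC : 1 ≤ C) {φ : ℂ → ℝ}
    (hφ : HasCovecBound m C φ) {p : ℂ × ℝ} (hp : p ∈ epi φ) {r ε κ M : ℝ} (hr : 0 < r)
    (hκ : 1 ≤ κ) (hM : 0 ≤ M) (hsmall : ‖covec m φ p.1‖ ≤ κ * lam m p.1 r) (hε : 0 ≤ ε)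
    (hε1 : ε * (128 * C * (3 ^ (2 * m)) ^ 2) ≤ 1) :
    ∃ x : ℂ × ℝ, ‖x.1 - p.1‖ ≤ κ * r ∧ M * r * lam m x.1 (M * r) ≤ height φ x ∧
      JohnArc m (epi φ) ε ((κ + 4 * M) * r) p x := by
  rw [mem_epi_iff] at hp
  set z := p.1 with hz
  set a := ‖covec m φ z‖ with ha
  set g : ℝ := 3 ^ (2 * m) with hg
  have hg1 : 1 ≤ g := Real.one_le_rpow (by norm_num) (by linarith)
  have hCg : 1 ≤ C * g ^ 2 := by nlinarith
  have hC0 : 0 < C := by linarith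
  have ha0 : 0 ≤ a := norm_nonneg _
  -- the length of the horizontal piece
  obtain ⟨L, hL, hLa⟩ : ∃ L ∈ Icc 0 (κ * r), lam m z L = a / (2 * C) := by
    have hcont : ContinuousOn (lam m z) (Icc 0 (κ * r)) := by
      unfold lam
      refine Continuous.continuousOn (Continuous.mul (by fun_prop)
        (Continuous.rpow_const (by fun_prop) fun _ => Or.inr (by linarith)))
    refine intermediate_value_Icc (by positivity) hcont ⟨?_, ?_⟩
    · rw [lam, zero_mul]; positivity
    · have h1 := mul_lam_le hm z hr.le hκ
      refine le_trans (div_le_self ha0 (by linarith)) (by linarith)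
  have hL0 : 0 ≤ L := hL.1
  have haL : a = 2 * (C * lam m z L) := by rw [hLa]; field_simp
  have hlz : 0 ≤ lam m z L := lam_nonneg m z hL0
  -- comparison of the moduli at comparable scales
  have hcmp : ∀ (w w' : ℂ) (s s' k : ℝ), 0 ≤ s → 0 ≤ s' → 0 ≤ k → s ≤ k * s' →
      ‖w‖ + s ≤ 3 * (‖w'‖ + s') → lam m w s ≤ k * g * lam m w' s' := by
    intro w w' s s' k hs hs' hk h1 h2
    refine (lam_mono hm hs h1 h2).trans (le_of_eq ?_)
    have := norm_nonneg w'
    rw [Real.mul_rpow (by norm_num) (by positivity), lam]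
    ring
  obtain ⟨e, he, hae⟩ := exists_norm_eq_one_apply_eq_norm (covec m φ z)
  have hse : ∀ s : ℝ, 0 ≤ s → ‖(z + s * e) - z‖ = s := by
    intro s hs
    rw [add_sub_cancel_left, norm_mul, he, mul_one, Complex.norm_real, Real.norm_of_nonneg hs]
  have hosc : ∀ s ∈ Icc 0 L, ‖covec m φ (z + s * e) - covec m φ z‖ ≤ a / 2 := by
    intro s hs
    refine (hφ.bound _ _).trans ?_
    rw [hse s hs.1, haL]
    have := lam_le_lam hm z hs.1 hs.2
    have := mul_le_mul_of_nonneg_left this hC0.le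
    linarith
  have hh1 : ∀ s ∈ Icc 0 L, a / 2 ≤ covec m φ (z + s * e) e := by
    intro s hs
    have h1 := (covec m φ (z + s * e) - covec m φ z).le_opNorm e
    rw [he, mul_one, Real.norm_eq_abs, sub_apply, hae] at h1
    linarith [neg_abs_le (covec m φ (z + s * e) e - a), hosc s hs]
  have harc := hφ.johnArc_segLift hm hC0.le hp he (κ := a / 2) (B := (3 + g) / 2 * a) hL0
    (by positivity) hε (by nlinarith) (by
      have h1 : ε * (8 * g) ≤ 1 := by
        refine le_trans (mul_le_mul_of_nonneg_left ?_ hε) hε1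
        nlinarith
      have h2 : ε * (2 * (3 + g)) ≤ 1 :=
        le_trans (mul_le_mul_of_nonneg_left (by linarith) hε) h1
      nlinarith) hh1 fun s hs => by
      have h1 := norm_le_norm_add_norm_sub' (covec m φ (z + s * e)) (covec m φ z)
      have h2 := hosc s hs
      have h3 := hcmp (z + s * e) z s L 1 hs.1 hL0 zero_le_one (by linarith [hs.2]) (by
        have := norm_le_norm_add_norm_sub' (z + s * e) z
        rw [hse s hs.1] at this
        linarith [hs.2, norm_nonneg z])
      have h4 := mul_le_mul_of_nonneg_left h3 hC0.le
      nlinarith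
  have hhx := height_segLift_ge hm hφ.contDiff p e hL0 hh1
  set x := segLift m p e L with hx
  have hx1 : x.1 = z + L * e := by simp [hx, segLift, hz]
  have hxz : ‖x.1 - z‖ = L := by rw [hx1, hse L hL0]
  have hMr : 0 ≤ M * r := by positivity
  have hclimb := harc.vertical hm hC0.le hφ hε hL0 hMr fun s hs => by
    set σ := L + s with hσ
    have hs0 : 0 ≤ s := hs.1
    have hσ0 : 0 ≤ σ := by positivity
    have hls : 0 ≤ lam m x.1 s := lam_nonneg m _ hs0
    have hlσ : 0 ≤ lam m x.1 σ := lam_nonneg m _ hσ0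
    have hε8 : ε * 8 ≤ 1 := by
      refine le_trans (mul_le_mul_of_nonneg_left ?_ hε) hε1
      nlinarith
    have hρ0 : 0 ≤ ε * (2 * (L + 4 * s)) := by positivity
    have hρ8 : ε * (2 * (L + 4 * s)) ≤ ε * 8 * σ := by
      have : 2 * (L + 4 * s) ≤ 8 * σ := by rw [hσ]; linarith
      nlinarith
    have hρ1 : ε * (2 * (L + 4 * s)) ≤ σ := hρ8.trans (mul_le_of_le_one_left hσ0 hε8)
    have hzx : ‖z‖ ≤ ‖x.1‖ + L := by
      have := norm_le_norm_add_norm_sub' z x.1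
      rwa [norm_sub_rev, hxz] at this
    have hxz' : ‖x.1‖ ≤ ‖z‖ + L := by
      have := norm_le_norm_add_norm_sub' x.1 z
      rwa [hxz] at this
    have n1 := norm_nonneg z
    have n2 := norm_nonneg x.1
    have h1 : ‖covec m φ x.1‖ ≤ 3 * (C * (g * lam m x.1 σ)) := by
      have h2 := hφ.norm_covec_le z x.1
      rw [hxz] at h2
      have h3 := hcmp z x.1 L σ 1 hL0 hσ0 zero_le_one (by linarith) (by linarith)
      have h4 := mul_le_mul_of_nonneg_left h3 hC0.le
      linarith
    have h2 : C * lam m x.1 (ε * (2 * (L + 4 * s))) ≤ C * (g * lam m x.1 σ) := by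
      gcongr
      exact (lam_le_lam hm _ hρ0 hρ1).trans (le_mul_of_one_le_left hlσ hg1)
    have h3 : σ * lam m x.1 σ ≤ 4 * g * (s * lam m x.1 s + L * lam m z L) := by
      rcases le_total L s with h | h
      · have h4 := hcmp x.1 x.1 σ s 2 hσ0 hs0 zero_le_two (by linarith) (by linarith)
        calc σ * lam m x.1 σ ≤ (2 * s) * (2 * g * lam m x.1 s) := by gcongr; linarith
          _ = 4 * g * (s * lam m x.1 s) := by ring
          _ ≤ _ := by
            gcongr
            exact le_add_of_nonneg_right (by positivity)
      · have h4 := hcmp x.1 z σ L 2 hσ0 hL0 zero_le_two (by linarith) (by linarith)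
        calc σ * lam m x.1 σ ≤ (2 * L) * (2 * g * lam m z L) := by gcongr; linarith
          _ = 4 * g * (L * lam m z L) := by ring
          _ ≤ _ := by
            gcongr
            exact le_add_of_nonneg_left (by positivity)
    have hLC : L * lam m z L ≤ L * (C * lam m z L) := by
      gcongr
      exact le_mul_of_one_le_left hlz hC
    calc ε * (2 * (L + 4 * s)) * (‖covec m φ x.1‖ + C * lam m x.1 (ε * (2 * (L + 4 * s))))
        ≤ (ε * 8 * σ) * (4 * (C * (g * lam m x.1 σ))) := by
          refine mul_le_mul hρ8 (by linarith) ?_ (by positivity)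
          have := lam_nonneg m x.1 hρ0
          positivity
      _ = ε * 32 * C * g * (σ * lam m x.1 σ) := by ring
      _ ≤ ε * 32 * C * g * (4 * g * (s * lam m x.1 s + L * lam m z L)) := by gcongr
      _ = ε * (128 * C * g ^ 2) * (s * lam m x.1 s + L * lam m z L) := by ring
      _ ≤ s * lam m x.1 s + L * lam m z L := mul_le_of_le_one_left (by positivity) hε1
      _ < height φ x + s * lam m x.1 s := by
          have : a / 2 * L = L * (C * lam m z L) := by rw [haL]; ring
          linarith
  have hx0 : 0 ≤ height φ x := by
    have : 0 ≤ a / 2 * L := by positivity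
    linarith
  refine ⟨_, ?_, ?_, hclimb.mono le_rfl ?_⟩
  · change ‖x.1 - z‖ ≤ κ * r
    rw [hxz]; exact hL.2
  · simp only [height] at hx0 ⊢
    linarith
  · linarith [hL.2]

/-- The characteristic regime: both points climb to a large multiple of the scale `r`, where all
points at distance comparable to `r` are far from the graph. -/
theorem HasCovecBound.exists_johnArcs_of_small {m C : ℝ} (hm : 1 ≤ m) (hC : 1 ≤ C) {φ : ℂ → ℝ}
    (hφ : HasCovecBound m C φ) {K : ℝ} (hK : 0 ≤ K) :
    ∃ ε₀ > 0, ∃ A > 0, ∀ ε, 0 ≤ ε → ε ≤ ε₀ → ∀ p ∈ epi φ, ∀ q ∈ epi φ, ∀ r > 0,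
      ccDist m p q < ENNReal.ofReal r → ‖covec m φ p.1‖ ≤ K * lam m p.1 r →
      ∃ x, JohnArc m (epi φ) ε (A * r) p x ∧ JohnArc m (epi φ) ε (A * r) q x := by
  have h21 : (1 : ℝ) ≤ 2 ^ (2 * m) := Real.one_le_rpow (by norm_num) (by linarith)
  set κ := 2 ^ (2 * m) * (K + C) with hκ
  have hκK : K ≤ κ := by nlinarith
  have hκ1 : 1 ≤ κ := by nlinarith
  set β := K + C * (κ + 2) * (κ + 2) ^ (2 * m) with hβ
  have hβ0 : 0 < β := by positivity
  -- `β r (|z| + r)^{2m}` bounds the gradient near `p`; `M` makes the height at scale `M r` beat it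
  set M := β * (2 * κ + 2) + κ + 2 with hM
  have hβκ : 0 < β * (2 * κ + 2) := by positivity
  have hM1 : κ + 2 ≤ M := by linarith
  have hM2 : β * (2 * κ + 2) ≤ M ^ 2 := by nlinarith
  set A := (κ + 4 * M) + (2 * κ + 1) +
    4 * ((2 * m + 1) * ((2 * κ + 1) + (κ + 4 * M) + (1 + (κ + 4 * M)) + 1)) with hA
  have hM0 : 0 < M := by linarith
  have hA0 : 0 < A := by positivity
  have hA1 : κ + 4 * M ≤ A := by
    have : 0 ≤ (2 * κ + 1) +
      4 * ((2 * m + 1) * ((2 * κ + 1) + (κ + 4 * M) + (1 + (κ + 4 * M)) + 1)) := by positivity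
    linarith
  refine ⟨min (1 / (128 * C * (3 ^ (2 * m)) ^ 2)) (1 / (4 * A)), by positivity, A, hA0, ?_⟩
  intro ε hε hε₀ p hp q hq r hr hpq hsmall
  have hε1 : ε * (128 * C * (3 ^ (2 * m)) ^ 2) ≤ 1 :=
    (le_div_iff₀ (by positivity)).1 (hε₀.trans (min_le_left _ _))
  have hε2 : ε * (4 * A) ≤ 1 := (le_div_iff₀ (by positivity)).1 (hε₀.trans (min_le_right _ _))
  have hqp : ‖q.1 - p.1‖ ≤ r := fst_sub_le_of_ccDist_lt hpq
  have hlp : 0 ≤ lam m p.1 r := lam_nonneg m _ hr.le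
  have hpn := norm_nonneg p.1
  have hqn := norm_nonneg q.1
  set R := ‖p.1‖ + r with hR
  have hR0 : 0 < R := by positivity
  set u := R ^ (2 * m) with hu
  have hu0 : 0 < u := by positivity
  have hlu : lam m p.1 r = r * u := rfl
  have hsmallq : ‖covec m φ q.1‖ ≤ κ * lam m q.1 r := by
    have h1 := hφ.norm_covec_le p.1 q.1
    have h2 := mul_le_mul_of_nonneg_left (lam_le_lam hm p.1 (norm_nonneg _) hqp)
      (by linarith : 0 ≤ C)
    have h3 : lam m p.1 r ≤ 2 ^ (2 * m) * lam m q.1 r := by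
      have h4 : ‖p.1‖ ≤ ‖q.1‖ + r := by
        have := norm_le_norm_add_norm_sub' p.1 q.1
        rw [norm_sub_rev] at this
        linarith
      refine (lam_mono hm hr.le le_rfl (r := 2 * (‖q.1‖ + r)) (by linarith)).trans (le_of_eq ?_)
      rw [Real.mul_rpow (by norm_num) (by positivity), lam]
      ring
    calc ‖covec m φ q.1‖ ≤ (K + C) * lam m p.1 r := by linarith
      _ ≤ (K + C) * (2 ^ (2 * m) * lam m q.1 r) := by gcongr
      _ = κ * lam m q.1 r := by rw [hκ]; ring
  obtain ⟨x, hxp, hhx, jx⟩ := hφ.exists_climb hm hC hp hr hκ1 hM0.le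
    (hsmall.trans (by gcongr)) hε hε1
  obtain ⟨y, hyq, hhy, jy⟩ := hφ.exists_climb hm hC hq hr hκ1 hM0.le hsmallq hε hε1
  have hyp : ‖y.1 - p.1‖ ≤ (κ + 1) * r := by
    have := norm_sub_le_norm_sub_add_norm_sub y.1 q.1 p.1
    linarith
  have hyx : ‖y.1 - x.1‖ ≤ (2 * κ + 1) * r := by
    have := norm_sub_le_norm_sub_add_norm_sub y.1 p.1 x.1
    rw [norm_sub_rev p.1 x.1] at this
    linarith
  have hhigh : ∀ w : ℂ × ℝ, ‖w.1 - p.1‖ ≤ (κ + 1) * r → M * r * lam m w.1 (M * r) ≤ height φ w →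
      β * r * u * ((2 * κ + 1) * r + r) ≤ height φ w := by
    intro w hw h
    have h1 : R ≤ ‖w.1‖ + M * r := by
      have h2 := norm_le_norm_add_norm_sub' p.1 w.1
      rw [norm_sub_rev] at h2
      have h3 : (κ + 2) * r ≤ M * r := by gcongr
      linarith
    have h4 : u ≤ (‖w.1‖ + M * r) ^ (2 * m) := Real.rpow_le_rpow hR0.le h1 (by linarith)
    calc β * r * u * ((2 * κ + 1) * r + r) = β * (2 * κ + 2) * (r ^ 2 * u) := by ring
      _ ≤ M ^ 2 * (r ^ 2 * u) := by gcongr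
      _ = M * r * (M * r * u) := by ring
      _ ≤ M * r * lam m w.1 (M * r) := by unfold lam; gcongr
      _ ≤ height φ w := h
  have hdy : ccDist m p y ≤ ENNReal.ofReal (r + (κ + 4 * M) * r) := by
    obtain ⟨γ, -, -, hγ1, hγ⟩ := id jy
    have := (hγ 1 (by simp)).2.1
    rw [hγ1] at this
    exact ccDist_add_le hr.le (by positivity) hpq.le this
  refine ⟨y, jx.connect hm (by linarith) hφ (E := r + (κ + 4 * M) * r) (ℓ := (2 * κ + 1) * r)
    (r := r) (b := β * r * u) hε (by positivity) (by positivity) hr (by positivity) hdy hyx ?_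
    (hhigh x (hxp.trans (by gcongr; linarith)) hhx) (hhigh y hyp hhy) (by rw [hA]; ring) ?_,
    jy.mono le_rfl (by gcongr)⟩
  · intro s hs
    set w := x.1 + s * (y.1 - x.1) with hw
    have hwp : ‖w - p.1‖ ≤ (κ + 1) * r := by
      have h1 : x.1 ∈ Metric.closedBall p.1 ((κ + 1) * r) := by
        rw [mem_closedBall_iff_norm]
        exact hxp.trans (by gcongr; linarith)
      have h2 : y.1 ∈ Metric.closedBall p.1 ((κ + 1) * r) := mem_closedBall_iff_norm.2 hyp
      have h3 := (convex_closedBall p.1 ((κ + 1) * r)).add_smul_sub_mem h1 h2 hs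
      rwa [Complex.real_smul, ← hw, mem_closedBall_iff_norm] at h3
    have hκR : ‖p.1‖ + (κ + 2) * r ≤ (κ + 2) * R := by
      rw [hR, mul_add]
      gcongr
      exact le_mul_of_one_le_left hpn (by linarith)
    have h1 : lam m p.1 ‖w - p.1‖ ≤ (κ + 1) * r * ((κ + 2) * R) ^ (2 * m) :=
      lam_mono hm (norm_nonneg _) hwp (by linarith)
    have h2 : lam m w r ≤ r * ((κ + 2) * R) ^ (2 * m) :=
      lam_mono hm hr.le le_rfl (by
        have := norm_le_norm_add_norm_sub' w p.1
        linarith)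
    have h3 := hφ.norm_covec_le p.1 w
    have h4 : C * lam m p.1 ‖w - p.1‖ + C * lam m w r ≤
        C * ((κ + 1) * r * ((κ + 2) * R) ^ (2 * m)) + C * (r * ((κ + 2) * R) ^ (2 * m)) := by
      gcongr
    rw [Real.mul_rpow (by positivity) hR0.le, ← hu] at h4
    rw [hlu] at hsmall
    calc ‖covec m φ w‖ + C * lam m w r ≤ K * (r * u) + (C * ((κ + 1) * r *
          ((κ + 2) ^ (2 * m) * u)) + C * (r * ((κ + 2) ^ (2 * m) * u))) := by linarith
      _ = β * r * u := by rw [hβ]; ring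
  · have := mul_le_mul_of_nonneg_right hε2 hr.le
    linarith

/-! ### Admissible functions -/

theorem isUniformDomain_epi {m C : ℝ} (hm : 1 ≤ m) (hC : 1 ≤ C) {φ : ℂ → ℝ}
    (hφ : HasCovecBound m C φ) : IsUniformDomain m (epi φ) := by
  refine ⟨isOpen_lt (hφ.contDiff.continuous.comp continuous_fst) continuous_snd, ?_⟩
  obtain ⟨ε₀, hε₀, A, hA, hsmall⟩ := hφ.exists_johnArcs_of_small hm hC
    (K := 40 * C * 9 ^ (2 * m)) (by positivity)
  set ε := min ε₀ (1 / (200 * (2 * m + 1))) with hε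
  have hk : 0 < 2 * m + 1 := by linarith
  have hε0 : 0 < ε := by positivity
  set D := max A (50 * (2 * m + 1)) with hD
  have hD0 : 0 < D := lt_max_of_lt_left hA
  refine ⟨ε, hε0, 1 / (8 * D), by positivity, fun p hp q hq => ?_⟩
  by_cases hd : ccDist m p q = 0
  · -- points at distance zero coincide
    have hlt : ∀ ρ > 0, ccDist m p q < ENNReal.ofReal ρ := fun ρ hρ => by
      rw [hd]; exact ENNReal.ofReal_pos.2 hρ
    have h1 : q.1 = p.1 := by
      have : ‖q.1 - p.1‖ ≤ 0 := le_of_forall_pos_le_add fun ρ hρ => by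
        rw [zero_add]; exact fst_sub_le_of_ccDist_lt (hlt ρ hρ)
      exact sub_eq_zero.1 (norm_le_zero_iff.1 this)
    have h2 : q.2 = p.2 := by
      have hlt' : ∀ ρ > 0, ρ ≤ 1 → |q.2 - p.2| ≤ (2 * m + 1) * lam m p.1 1 * ρ := by
        intro ρ hρ hρ1
        have h3 : ccDist m (p.1, p.2) (p.1, q.2) < ENNReal.ofReal ρ := by
          have := hlt ρ hρ
          rwa [show (p.1, q.2) = q from Prod.ext h1.symm rfl]
        refine (abs_snd_sub_le_of_ccDist_lt hm h3).trans ?_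
        have := lam_le_lam hm p.1 hρ.le hρ1
        calc (2 * m + 1) * (ρ * lam m p.1 ρ) ≤ (2 * m + 1) * (ρ * lam m p.1 1) := by gcongr
          _ = _ := by ring
      set B := (2 * m + 1) * lam m p.1 1 with hB
      have hB0 : 0 ≤ B := by have := lam_nonneg m p.1 zero_le_one; positivity
      by_contra hne
      have hpos : 0 < |q.2 - p.2| := abs_pos.2 (sub_ne_zero.2 hne)
      have h3 := hlt' (min 1 (|q.2 - p.2| / (2 * (B + 1)))) (by positivity) (min_le_left _ _)
      have h4 : B * min 1 (|q.2 - p.2| / (2 * (B + 1))) ≤ (B + 1) * (|q.2 - p.2| / (2 * (B + 1))) := by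
        gcongr
        · linarith
        · exact min_le_right _ _
      have h5 : (B + 1) * (|q.2 - p.2| / (2 * (B + 1))) = |q.2 - p.2| / 2 := by field_simp
      linarith
    obtain rfl : q = p := Prod.ext h1 h2
    have himg : ∀ S : Set ℝ, ccDiam m ((fun _ : ℝ => q) '' S) = 0 := fun S => by
      refine le_antisymm (iSup₂_le fun x hx => iSup₂_le fun y hy => ?_) zero_le
      obtain ⟨_, -, rfl⟩ := hx
      obtain ⟨_, -, rfl⟩ := hy
      exact (ccDist_self m q).le
    refine ⟨fun _ => q, continuousOn_const, fun _ _ => hp, rfl, rfl, ?_, fun t _ => ?_⟩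
    · rw [himg]; exact zero_le
    · rw [himg, himg, min_self, mul_zero]
      intro x hx
      exact absurd (show ccDist m q x < 0 from hx) not_lt_zero
  -- the factor `2` makes the inequality `ccDist m p q < r` strict
  · set r := 2 * (ccDist m p q).toReal with hr
    have hdt : ccDist m p q ≠ ⊤ := ccDist_ne_top hm p q
    have hd0 : 0 < (ccDist m p q).toReal := ENNReal.toReal_pos hd hdt
    have hr0 : 0 < r := by positivity
    have hpq : ccDist m p q < ENNReal.ofReal r := by
      rw [← ENNReal.ofReal_toReal hdt, ENNReal.ofReal_lt_ofReal_iff hr0]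
      linarith
    obtain ⟨x, hx1, hx2⟩ : ∃ x, JohnArc m (epi φ) ε (D * r) p x ∧ JohnArc m (epi φ) ε (D * r) q x := by
      rcases le_total (40 * C * 9 ^ (2 * m) * lam m p.1 r) ‖covec m φ p.1‖ with h | h
      · obtain ⟨x, h1, h2⟩ := hφ.exists_johnArcs_of_large hm hC hp hq hr0 hpq h hε0.le
          ((le_div_iff₀ (by positivity)).1 (min_le_right _ _))
        have h3 : 50 * (2 * m + 1) * r ≤ D * r := by
          gcongr
          exact le_max_right _ _
        exact ⟨x, h1.mono le_rfl h3, h2.mono le_rfl h3⟩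
      · obtain ⟨x, h1, h2⟩ := hsmall ε hε0.le (min_le_left _ _) p hp q hq r hr0 hpq h
        have h3 : A * r ≤ D * r := by
          gcongr
          exact le_max_left _ _
        exact ⟨x, h1.mono le_rfl h3, h2.mono le_rfl h3⟩
    obtain ⟨γ, h1, h2, h3, h4, h5, h6⟩ := hx1.exists_curve (by positivity) hx2
    refine ⟨γ, h1, h2, h3, h4, h5.trans (le_of_eq ?_), h6⟩
    rw [one_div, inv_inv, hr, show 4 * (D * (2 * (ccDist m p q).toReal)) =
      8 * D * (ccDist m p q).toReal by ring, ENNReal.ofReal_mul (by positivity),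
      ENNReal.ofReal_toReal hdt]

theorem abs_apply_le_maxPartial (φ : ℂ → ℝ) (z : ℂ) (j : Fin 2 → Fin 2) :
    |iteratedFDeriv ℝ 2 φ z (fun i => ![(1 : ℂ), Complex.I] (j i))| ≤ maxPartial 2 φ z :=
  le_ciSup (f := fun j : Fin 2 → Fin 2 =>
    |iteratedFDeriv ℝ 2 φ z (fun i => ![(1 : ℂ), Complex.I] (j i))|) (Set.finite_range _).bddAbove j

theorem norm_fderiv_fderiv_le (φ : ℂ → ℝ) (z : ℂ) :
    ‖fderiv ℝ (fderiv ℝ φ) z‖ ≤ 4 * maxPartial 2 φ z := by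
  have h := fun i j => abs_apply_le_maxPartial φ z ![i, j]
  simp only [iteratedFDeriv_two_apply, Matrix.cons_val_zero, Matrix.cons_val_one] at h
  set T := fderiv ℝ (fderiv ℝ φ) z
  set c := maxPartial 2 φ z
  have hc : 0 ≤ c := (abs_nonneg _).trans (h 0 0)
  have hdec : ∀ u : ℂ, u = u.re • (1 : ℂ) + u.im • Complex.I := fun u => by
    apply Complex.ext <;> simp
  refine T.opNorm_le_bound (by positivity) fun u => (T u).opNorm_le_bound (by positivity) fun v => ?_
  have h00 := h 0 0
  have h01 := h 0 1
  have h10 := h 1 0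
  have h11 := h 1 1
  simp only [Matrix.cons_val_zero, Matrix.cons_val_one] at h00 h01 h10 h11
  have e : T u v = u.re * (v.re * T 1 1) + u.re * (v.im * T 1 Complex.I)
      + u.im * (v.re * T Complex.I 1) + u.im * (v.im * T Complex.I Complex.I) := by
    conv_lhs => rw [hdec u, hdec v]
    simp only [map_add, map_smul, add_apply, smul_apply,
      smul_eq_mul]
    ring
  have hprod : ∀ x y t : ℝ, |x| ≤ ‖u‖ → |y| ≤ ‖v‖ → |t| ≤ c → |x * (y * t)| ≤ c * ‖u‖ * ‖v‖ := by
    intro x y t hx hy ht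
    rw [abs_mul, abs_mul]
    calc |x| * (|y| * |t|) ≤ ‖u‖ * (‖v‖ * c) := by gcongr
      _ = _ := by ring
  have ur := Complex.abs_re_le_norm u
  have ui := Complex.abs_im_le_norm u
  have vr := Complex.abs_re_le_norm v
  have vi := Complex.abs_im_le_norm v
  rw [e, Real.norm_eq_abs]
  refine (abs_add_le _ _).trans ?_
  refine (add_le_add ((abs_add_le _ _).trans (add_le_add (abs_add_le _ _) le_rfl)) le_rfl).trans ?_
  linarith [hprod _ _ _ ur vr h00, hprod _ _ _ ur vi h01, hprod _ _ _ ui vr h10,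
    hprod _ _ _ ui vi h11]

/-- Of the bounds that define admissible functions only the one on second derivatives is needed. -/
theorem hasCovecBound_of_maxPartial_le {m C : ℝ} (hm : 1 ≤ m) (hC : 0 ≤ C) {φ : ℂ → ℝ}
    (hφ : ContDiff ℝ 2 φ) (h : ∀ z, maxPartial 2 φ z ≤ C * ‖z‖ ^ (2 * m)) :
    HasCovecBound m (4 * C + (2 * m + 1)) φ := by
  refine ⟨hφ.of_le (by norm_num), fun z w => ?_⟩
  have hd : Differentiable ℝ (fderiv ℝ φ) :=
    (hφ.fderiv_right (m := 1) (by norm_num)).differentiable one_ne_zero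
  have h1 : ‖fderiv ℝ φ w - fderiv ℝ φ z‖ ≤
      4 * (C * (‖z‖ + ‖w - z‖) ^ (2 * m)) * ‖w - z‖ := by
    refine (convex_closedBall z ‖w - z‖).norm_image_sub_le_of_norm_fderiv_le (𝕜 := ℝ)
      (fun x _ => hd x) (fun x hx => ?_) (by simp) (by simp [dist_eq_norm])
    refine (norm_fderiv_fderiv_le φ x).trans ?_
    have hx' : ‖x‖ ≤ ‖z‖ + ‖w - z‖ := by
      have := norm_le_norm_add_norm_sub' x z
      rw [mem_closedBall_iff_norm] at hx
      linarith
    have : ‖x‖ ^ (2 * m) ≤ (‖z‖ + ‖w - z‖) ^ (2 * m) :=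
      Real.rpow_le_rpow (norm_nonneg _) hx' (by linarith)
    have := mul_le_mul_of_nonneg_left this hC
    linarith [h x]
  have h2 := norm_eta_sub_le hm z w
  calc ‖covec m φ w - covec m φ z‖
      = ‖(eta m w - eta m z) - (fderiv ℝ φ w - fderiv ℝ φ z)‖ := by
        unfold covec; congr 1; abel
    _ ≤ _ := norm_sub_le _ _
    _ ≤ (2 * m + 1) * lam m z ‖w - z‖ + 4 * (C * (‖z‖ + ‖w - z‖) ^ (2 * m)) * ‖w - z‖ :=
        add_le_add h2 h1
    _ = _ := by unfold lam; ring

theorem theorem5p1 (m : ℝ) (hm : 1 ≤ m) (φ : ℂ → ℝ) (hφ : ContDiff ℝ ∞ φ)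
    (hadm : IsAdmissible m φ) : IsUniformDomain m (epi φ) := by
  obtain ⟨C, hC, h⟩ := hadm
  exact isUniformDomain_epi hm (by linarith) (hasCovecBound_of_maxPartial_le hm hC.le
    (contDiff_infty.1 hφ 2) fun z => (h z).2.1)
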